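/- Let $n\in\mathbb N$ and let $\mathbb R^n$ carry the Euclidean norm. For $e\in\mathbb R^n\setminus\{0\}$ and $\alpha\in(0,1]$ let $C_{e,\alpha}=\{x\in\mathbb R^n:\langle x,e\rangle\ge\alpha\|x\|\|e\|\}$ and let $\Gamma_{e,\alpha}$ be the set of Lipschitz curves $\gamma:\mathbb R\to\mathbb R^n$ with $\gamma'(t)\in C_{e,\alpha}$ for almost every $t$. For open $G\subset\mathbb R^n$ put $w_{e,\alpha}(G)=\sup\{\mathcal H^1(G\cap\gamma(\mathbb R)):\gamma\in\Gamma_{e,\alpha}\}$, and for arbitrary $E\subset\mathbb R^n$ put $w_{e,\alpha}(E)=\inf\{w_{e,\alpha}(G):G\supset E,\ G\text{ open}\}$. When $e=0$ or $\alpha>1$, let $w_{e,\alpha}(E)=0$ for every $E$. For $x\in E$ let $$\mathcal N(E,x)=\{e\in\mathbb R^n:(\forall\varepsilon>0)(\exists r>0)\ w_{e,\varepsilon}(B(x,r)\cap E)=0\},$$ where $B(x,r)$ is the open ball. The set $E$ is called cone unrectifiable if $\mathcal N(E,x)\ne\{0\}$ for every $x\in E$. Write $$D^+f(x;y)=\limsup_{t\searrow0}\frac{f(x+ty)-f(x)}t,\qquad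 D_+f(x;y)=\liminf_{t\searrow0}\frac{f(x+ty)-f(x)}t.$$ Theorem. Let $E=\bigcup_k E_k\subset\mathbb R^n$ be a countable union of pairwise disjoint cone unrectifiable $F_\sigma$ sets $E_k$. Then there is a Lipschitz function $f:\mathbb R^n\to\mathbb R$ such that (1) $f$ is differentiable at every $x\in\mathbb R^n\setminus E$; (2) for every $k$ and every $x\in E_k$ there is $c>0$ such that, for every $y\in\mathbb R^n$, $$D^+f(x;y)-D_+f(x;y)\ \ge\ c\,\sup\{\langle e,y\rangle: e\in\mathcal N(E_k,x),\ \|e\|\le1\};$$ (3) in particular, $f$ is not differentiable at any $x\in E$. -/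

import Mathlib

open scoped ENNReal NNReal Topology MeasureTheory

namespace ConeUnrect

/-- The one-sided cone `C_{e,α} = {x : ⟨x, e⟩ ≥ α ‖x‖ ‖e‖}`. -/
def coneSet {n : ℕ} (e : EuclideanSpace ℝ (Fin n)) (α : ℝ) : Set (EuclideanSpace ℝ (Fin n)) :=
  {x | α * ‖x‖ * ‖e‖ ≤ inner ℝ x e}

/-- `Γ_{e,α}`: the Lipschitz curves `γ : ℝ → ℝⁿ` with `γ'(t) ∈ C_{e,α}` for almost every `t`.
(A Lipschitz curve is differentiable almost everywhere, so the value of `deriv` at points of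
non-differentiability does not matter.) -/
def coneCurves {n : ℕ} (e : EuclideanSpace ℝ (Fin n)) (α : ℝ) :
    Set (ℝ → EuclideanSpace ℝ (Fin n)) :=
  {γ | (∃ K : ℝ≥0, LipschitzWith K γ) ∧
    ∀ᵐ t ∂(MeasureTheory.volume : MeasureTheory.Measure ℝ), deriv γ t ∈ coneSet e α}

/-- The `(e,α)`-width of an open set `G`: the supremum of the one-dimensional Hausdorff measures of
`G ∩ γ(ℝ)` over the curves `γ ∈ Γ_{e,α}`. -/
noncomputable def openWidth {n : ℕ} (e : EuclideanSpace ℝ (Fin n)) (α : ℝ)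
    (G : Set (EuclideanSpace ℝ (Fin n))) : ℝ≥0∞ :=
  ⨆ γ ∈ coneCurves e α, MeasureTheory.Measure.hausdorffMeasure 1 (G ∩ Set.range γ)

open Classical in
/-- The `(e,α)`-width `w_{e,α}(E)` of an arbitrary set `E`: the infimum of the widths of the open
sets containing `E`, with the convention that it is zero when `e = 0` or `α > 1`. -/
noncomputable def width {n : ℕ} (e : EuclideanSpace ℝ (Fin n)) (α : ℝ)
    (E : Set (EuclideanSpace ℝ (Fin n))) : ℝ≥0∞ :=
  if e = 0 ∨ 1 < α then 0
  else ⨅ (G : Set (EuclideanSpace ℝ (Fin n))) (_ : IsOpen G) (_ : E ⊆ G), openWidth e α G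

/-- `𝒩(E,x)`: the vectors `e` such that for every `ε > 0` there is `r > 0` with
`w_{e,ε}(B(x,r) ∩ E) = 0`. -/
def normalSet {n : ℕ} (E : Set (EuclideanSpace ℝ (Fin n))) (x : EuclideanSpace ℝ (Fin n)) :
    Set (EuclideanSpace ℝ (Fin n)) :=
  {e | ∀ ε : ℝ, 0 < ε → ∃ r : ℝ, 0 < r ∧ width e ε (Metric.ball x r ∩ E) = 0}

/-- `E` is cone unrectifiable if `𝒩(E,x) ≠ {0}` for every `x ∈ E`. -/
def IsConeUnrectifiable {n : ℕ} (E : Set (EuclideanSpace ℝ (Fin n))) : Prop :=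
  ∀ x ∈ E, normalSet E x ≠ {0}

/-- `E` is an `F_σ` set: a countable union of closed sets. -/
def IsFSigma {n : ℕ} (E : Set (EuclideanSpace ℝ (Fin n))) : Prop :=
  ∃ F : ℕ → Set (EuclideanSpace ℝ (Fin n)), (∀ j, IsClosed (F j)) ∧ E = ⋃ j, F j

/-- The upper directional derivative `D⁺f(x;y)`. It is only used for Lipschitz `f`, where the
difference quotients are bounded and the real-valued `limsup` is the usual one. -/
noncomputable def upperDeriv {n : ℕ} (f : EuclideanSpace ℝ (Fin n) → ℝ)
    (x y : EuclideanSpace ℝ (Fin n)) : ℝ :=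
  Filter.limsup (fun t : ℝ => (f (x + t • y) - f x) / t) (𝓝[>] (0 : ℝ))

/-- The lower directional derivative `D₊f(x;y)`. It is only used for Lipschitz `f`, where the
difference quotients are bounded and the real-valued `liminf` is the usual one. -/
noncomputable def lowerDeriv {n : ℕ} (f : EuclideanSpace ℝ (Fin n) → ℝ)
    (x y : EuclideanSpace ℝ (Fin n)) : ℝ :=
  Filter.liminf (fun t : ℝ => (f (x + t • y) - f x) / t) (𝓝[>] (0 : ℝ))

end ConeUnrect

namespace ConeUnrect

open Set Filter MeasureTheory

variable {n : ℕ}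

local notation "𝕏" => EuclideanSpace ℝ (Fin n)

theorem zero_mem_coneSet (e : 𝕏) (α : ℝ) : (0 : 𝕏) ∈ coneSet e α := by
  simp [coneSet]

/-- The curve `γ`, eventually constant, continued by a segment. -/
theorem exists_coneCurves_extend {e : 𝕏} {α : ℝ} {γ : ℝ → 𝕏} (hγ : γ ∈ coneCurves e α)
    {T : ℝ} {x : 𝕏} (hT : ∀ t, T ≤ t → γ t = x) {v : 𝕏} (hv : v ∈ coneSet e α) :
    ∃ γ' ∈ coneCurves e α, ∃ T', (∀ t, T' ≤ t → γ' t = x + v) ∧ range γ ⊆ range γ' ∧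
      ∀ s ∈ Icc (0 : ℝ) 1, x + s • v ∈ range γ' := by
  obtain ⟨⟨K, hK⟩, hder⟩ := hγ
  set c : ℝ → ℝ := fun t => max 0 (min 1 (t - T)) with hc
  have hcl : LipschitzWith 1 c := by
    have h1 : LipschitzWith 1 (fun t : ℝ => t - T) := by
      apply LipschitzWith.of_dist_le_mul
      intro a b; simp
    exact (h1.const_min 1).const_max 0
  refine ⟨fun t => γ t + c t • v, ⟨⟨K + ‖v‖₊, ?_⟩, ?_⟩, T + 1, ?_, ?_, ?_⟩
  · refine hK.add ?_
    apply LipschitzWith.of_dist_le_mul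
    intro a b
    rw [dist_eq_norm, ← sub_smul, norm_smul, mul_comm, ← dist_eq_norm]
    have := hcl.dist_le_mul a b
    simp only [NNReal.coe_one, one_mul] at this
    exact mul_le_mul_of_nonneg_left this (norm_nonneg _)
  · have h1 : ∀ᵐ t : ℝ, t ≠ T := by simp [ae_iff]
    have h2 : ∀ᵐ t : ℝ, t ≠ T + 1 := by simp [ae_iff]
    filter_upwards [hder, h1, h2] with t ht h1 h2
    rcases lt_or_gt_of_ne h1 with h | h
    · have : (fun t => γ t + c t • v) =ᶠ[𝓝 t] γ := by
        filter_upwards [Iio_mem_nhds h] with s hs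
        have : c s = 0 := by
          simp only [hc]; rw [max_eq_left]
          exact (min_le_right _ _).trans (by linarith [mem_Iio.1 hs])
        simp [this]
      rw [this.deriv_eq]; exact ht
    · rcases lt_or_gt_of_ne h2 with h' | h'
      · have : (fun t => γ t + c t • v) =ᶠ[𝓝 t] fun t => x + (t - T) • v := by
          filter_upwards [Ioo_mem_nhds h h'] with s hs
          have : c s = s - T := by
            simp only [hc]; rw [min_eq_right (by linarith [hs.2]), max_eq_right (by linarith [hs.1])]
          rw [hT s hs.1.le, this]
        rw [this.deriv_eq]
        have : HasDerivAt (fun t : ℝ => x + (t - T) • v) ((1 : ℝ) • v) t :=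
          (((hasDerivAt_id t).sub_const T).smul_const v).const_add x
        rw [this.deriv, one_smul]; exact hv
      · have : (fun t => γ t + c t • v) =ᶠ[𝓝 t] fun t => x + v := by
          filter_upwards [Ioi_mem_nhds h'] with s hs
          have hs' : T + 1 < s := hs
          have : c s = 1 := by
            simp only [hc]; rw [min_eq_left (by linarith), max_eq_right zero_le_one]
          rw [hT s (by linarith), this, one_smul]
        rw [this.deriv_eq, deriv_const]; exact zero_mem_coneSet _ _
  · intro t ht
    have : c t = 1 := by
      simp only [hc]; rw [min_eq_left (by linarith), max_eq_right zero_le_one]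
    simp only [this, one_smul]
    rw [hT t (by linarith)]
  · have key : ∀ t, t ≤ T → γ t + c t • v = γ t := by
      intro t ht
      have : c t = 0 := by
        simp only [hc]; rw [max_eq_left]
        exact (min_le_right _ _).trans (by linarith)
      simp [this]
    rintro _ ⟨t, rfl⟩
    rcases le_total t T with h | h
    · exact ⟨t, key t h⟩
    · exact ⟨T, by simp only [key T le_rfl]; rw [hT T le_rfl, hT t h]⟩
  · intro s hs
    refine ⟨T + s, ?_⟩
    have : c (T + s) = s := by
      simp only [hc, add_sub_cancel_left]
      rw [min_eq_right hs.2, max_eq_right hs.1]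
    simp only [this]
    rw [hT _ (by linarith [hs.1])]

/-- `Reach e α G x L`: there is a polygonal chain with steps in the cone `C_{e,α}`, ending at `x`,
whose steps parallel to `e` that lie in `G` include a total length `L`. -/
inductive Reach (e : EuclideanSpace ℝ (Fin n)) (α : ℝ) (G : Set (EuclideanSpace ℝ (Fin n))) :
    EuclideanSpace ℝ (Fin n) → ℝ → Prop
  | base (x : EuclideanSpace ℝ (Fin n)) : Reach e α G x 0
  | step {x v : EuclideanSpace ℝ (Fin n)} {L : ℝ} (h : Reach e α G x L) (hv : v ∈ coneSet e α) :
      Reach e α G (x + v) L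
  | gain {x : EuclideanSpace ℝ (Fin n)} {L t : ℝ} (h : Reach e α G x L) (ht : 0 ≤ t)
      (hG : ∀ s ∈ Set.Icc 0 t, x + s • e ∈ G) : Reach e α G (x + t • e) (L + t)

theorem smul_mem_coneSet_self {e : 𝕏} {α t : ℝ} (hα : α ≤ 1) (ht : 0 ≤ t) :
    t • e ∈ coneSet e α := by
  simp only [coneSet, mem_ofPred_eq, norm_smul, Real.norm_eq_abs, abs_of_nonneg ht,
    real_inner_smul_left, real_inner_self_eq_norm_sq]
  have : 0 ≤ t * ‖e‖ ^ 2 := by positivity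
  nlinarith

theorem Reach.exists_curve {e : 𝕏} {α : ℝ} (he : ‖e‖ = 1) (h0 : 0 ≤ α) (h1 : α ≤ 1)
    {G : Set 𝕏} {x : 𝕏} {L : ℝ} (h : Reach e α G x L) :
    ∃ γ ∈ coneCurves e α, ∃ T, (∀ t, T ≤ t → γ t = x) ∧
      ENNReal.ofReal L ≤ volume ((fun z : 𝕏 => inner ℝ z e) '' (G ∩ range γ) ∩ Iic (inner ℝ x e)) := by
  induction h with
  | base x =>
    refine ⟨fun _ => x, ⟨⟨0, LipschitzWith.const x⟩, ?_⟩, 0, fun _ _ => rfl, by simp⟩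
    simp [zero_mem_coneSet]
  | @step x v L h hv ih =>
    obtain ⟨γ, hγ, T, hT, hL⟩ := ih
    obtain ⟨γ', hγ', T', hT', hr, -⟩ := exists_coneCurves_extend hγ hT hv
    refine ⟨γ', hγ', T', hT', hL.trans (measure_mono ?_)⟩
    refine inter_subset_inter (image_mono (inter_subset_inter_right _ hr)) (Iic_subset_Iic.2 ?_)
    rw [inner_add_left]
    have : 0 ≤ (inner ℝ v e : ℝ) := le_trans (by positivity) hv
    linarith
  | @gain x L t h ht hG ih =>
    obtain ⟨γ, hγ, T, hT, hL⟩ := ih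
    obtain ⟨γ', hγ', T', hT', hr, hs⟩ :=
      exists_coneCurves_extend hγ hT (smul_mem_coneSet_self (e := e) h1 ht)
    refine ⟨γ', hγ', T', hT', ?_⟩
    have hin : ∀ s : ℝ, (inner ℝ (x + s • e) e : ℝ) = inner ℝ x e + s := by
      intro s
      rw [inner_add_left, real_inner_smul_left, real_inner_self_eq_norm_sq, he]; ring
    set p : 𝕏 → ℝ := fun z => inner ℝ z e with hp
    have hsub : (p '' (G ∩ range γ) ∩ Iic (p x)) ∪ Ioc (p x) (p x + t) ⊆
        p '' (G ∩ range γ') ∩ Iic (p (x + t • e)) := by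
      rintro r (⟨⟨z, ⟨hzG, hz⟩, rfl⟩, hr'⟩ | hr')
      · refine ⟨⟨z, ⟨hzG, hr hz⟩, rfl⟩, ?_⟩
        have := hin t
        simp only [hp, mem_Iic] at hr' ⊢
        linarith
      · have ht0 : 0 < t := by linarith [hr'.1, hr'.2]
        refine ⟨⟨x + (r - p x) • e, ⟨hG _ ⟨by linarith [hr'.1], by linarith [hr'.2]⟩, ?_⟩, ?_⟩, ?_⟩
        · have := hs ((r - p x) / t) ⟨div_nonneg (by linarith [hr'.1]) ht,
            (div_le_one ht0).2 (by linarith [hr'.2])⟩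
          rwa [smul_smul, div_mul_cancel₀ _ ht0.ne'] at this
        · have := hin (r - p x)
          simp only [hp] at this ⊢
          linarith
        · have := hin t
          have := hr'.2
          simp only [hp, mem_Iic] at *
          linarith
    refine le_trans ?_ (measure_mono hsub)
    rw [measure_union ?_ measurableSet_Ioc, Real.volume_Ioc, add_sub_cancel_left]
    · exact ENNReal.ofReal_add_le.trans (add_le_add_left hL _)
    · rw [Set.disjoint_left]
      rintro r ⟨-, h1⟩ ⟨h2, -⟩
      exact absurd h2 (not_lt.2 h1)

theorem Reach.ofReal_le_openWidth {e : 𝕏} {α : ℝ} (he : ‖e‖ = 1) (h0 : 0 ≤ α) (h1 : α ≤ 1)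
    {G : Set 𝕏} {x : 𝕏} {L : ℝ} (h : Reach e α G x L) :
    ENNReal.ofReal L ≤ openWidth e α G := by
  obtain ⟨γ, hγ, T, -, hL⟩ := h.exists_curve he h0 h1
  have hp : LipschitzWith 1 (fun z : 𝕏 => (inner ℝ z e : ℝ)) := by
    apply LipschitzWith.of_dist_le_mul
    intro a b
    rw [Real.dist_eq, ← inner_sub_left, dist_eq_norm]
    have := abs_real_inner_le_norm (a - b) e
    simpa [he] using this
  have h2 := hp.hausdorffMeasure_image_le (d := 1) zero_le_one (G ∩ range γ)
  simp only [ENNReal.coe_one, ENNReal.one_rpow, one_mul, hausdorffMeasure_real] at h2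
  exact hL.trans ((measure_mono inter_subset_left).trans (h2.trans
    (le_iSup₂ (f := fun γ (_ : γ ∈ coneCurves e α) => μH[1] (G ∩ range γ)) γ hγ)))

/-- The potential of the open set `G` in the direction `e`. -/
noncomputable def potential (e : 𝕏) (α : ℝ) (G : Set 𝕏) (x : 𝕏) : ℝ :=
  sSup {r | ∃ s L : ℝ, 0 ≤ s ∧ Reach e α G (x + s • e) L ∧ r = L - s}

section potential

variable {e : EuclideanSpace ℝ (Fin n)} {α ε : ℝ} {G : Set (EuclideanSpace ℝ (Fin n))}

theorem le_potential (he : ‖e‖ = 1) (h0 : 0 ≤ α) (h1 : α ≤ 1) (hε : 0 ≤ ε)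
    (hG : openWidth e α G ≤ ENNReal.ofReal ε) {x : 𝕏} {s L : ℝ} (hs : 0 ≤ s)
    (h : Reach e α G (x + s • e) L) : L - s ≤ potential e α G x := by
  refine le_csSup ⟨ε, ?_⟩ ⟨s, L, hs, h, rfl⟩
  rintro r ⟨s, L, hs, h, rfl⟩
  have := (ENNReal.ofReal_le_ofReal_iff hε).1 ((h.ofReal_le_openWidth he h0 h1).trans hG)
  linarith

theorem potential_le_of {x : 𝕏} {c : ℝ}
    (H : ∀ s L : ℝ, 0 ≤ s → Reach e α G (x + s • e) L → L - s ≤ c) : potential e α G x ≤ c := by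
  refine csSup_le ⟨0 - 0, 0, 0, le_rfl, Reach.base _, rfl⟩ ?_
  rintro r ⟨s, L, hs, h, rfl⟩
  exact H s L hs h

theorem potential_nonneg (he : ‖e‖ = 1) (h0 : 0 ≤ α) (h1 : α ≤ 1) (hε : 0 ≤ ε)
    (hG : openWidth e α G ≤ ENNReal.ofReal ε) (x : 𝕏) : 0 ≤ potential e α G x := by
  simpa using le_potential he h0 h1 hε hG (x := x) le_rfl (Reach.base _)

theorem potential_le (he : ‖e‖ = 1) (h0 : 0 ≤ α) (h1 : α ≤ 1) (hε : 0 ≤ ε)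
    (hG : openWidth e α G ≤ ENNReal.ofReal ε) (x : 𝕏) : potential e α G x ≤ ε := by
  refine potential_le_of fun s L hs h => ?_
  have := (ENNReal.ofReal_le_ofReal_iff hε).1 ((h.ofReal_le_openWidth he h0 h1).trans hG)
  linarith

theorem potential_mono_cone (he : ‖e‖ = 1) (h0 : 0 ≤ α) (h1 : α ≤ 1) (hε : 0 ≤ ε)
    (hG : openWidth e α G ≤ ENNReal.ofReal ε) (x : 𝕏) {v : 𝕏} (hv : v ∈ coneSet e α) :
    potential e α G x ≤ potential e α G (x + v) := by
  refine potential_le_of fun s L hs h => ?_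
  refine le_potential he h0 h1 hε hG hs ?_
  have := h.step hv
  rwa [add_right_comm] at this

theorem potential_add_smul_le (he : ‖e‖ = 1) (h0 : 0 ≤ α) (h1 : α ≤ 1) (hε : 0 ≤ ε)
    (hG : openWidth e α G ≤ ENNReal.ofReal ε) (x : 𝕏) {t : ℝ} (ht : 0 ≤ t) :
    potential e α G (x + t • e) ≤ potential e α G x + t := by
  refine potential_le_of fun s L hs h => ?_
  have := le_potential he h0 h1 hε hG (x := x) (add_nonneg ht hs) (L := L)
    (by rwa [add_smul, ← add_assoc])
  linarith

theorem potential_add_smul_ge (he : ‖e‖ = 1) (h0 : 0 ≤ α) (h1 : α ≤ 1) (hε : 0 ≤ ε)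
    (hG : openWidth e α G ≤ ENNReal.ofReal ε) (x : 𝕏) {t : ℝ}
    (hseg : ∀ s ∈ Icc 0 t, x + s • e ∈ G) :
    potential e α G x + t ≤ potential e α G (x + t • e) := by
  suffices potential e α G x ≤ potential e α G (x + t • e) - t by linarith
  refine potential_le_of fun s L hs h => ?_
  rcases le_total t s with hts | hts
  · have := le_potential he h0 h1 hε hG (x := x + t • e) (sub_nonneg.2 hts) (L := L)
      (by rwa [add_assoc, ← add_smul, add_sub_cancel])
    linarith
  · have h2 := h.gain (sub_nonneg.2 hts) (fun r hr => by
      rw [add_assoc, ← add_smul]; exact hseg _ ⟨by linarith [hr.1], by linarith [hr.2]⟩)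
    rw [add_assoc, ← add_smul, add_sub_cancel] at h2
    have := le_potential he h0 h1 hε hG (x := x + t • e) le_rfl (L := L + (t - s))
      (by simpa using h2)
    linarith

theorem add_smul_mem_coneSet (he : ‖e‖ = 1) (h0 : 0 ≤ α) (h1 : α ≤ 1 / 2) {v : 𝕏}
    (hv : (inner ℝ v e : ℝ) = 0) : v + (2 * α * ‖v‖) • e ∈ coneSet e α := by
  have h2 : ‖v + (2 * α * ‖v‖) • e‖ ≤ ‖v‖ + 2 * α * ‖v‖ := by
    refine (norm_add_le _ _).trans ?_
    rw [norm_smul, he, Real.norm_eq_abs, abs_of_nonneg (by positivity), mul_one]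
  simp only [coneSet, mem_ofPred_eq, he, mul_one, inner_add_left, hv, real_inner_smul_left,
    real_inner_self_eq_norm_sq, zero_add, one_pow]
  calc α * ‖v + (2 * α * ‖v‖) • e‖ ≤ α * (‖v‖ + 2 * α * ‖v‖) := by gcongr
    _ = (α * ‖v‖) * (1 + 2 * α) := by ring
    _ ≤ (α * ‖v‖) * 2 := by gcongr; linarith
    _ = _ := by ring

theorem potential_perp (he : ‖e‖ = 1) (h0 : 0 ≤ α) (h1 : α ≤ 1 / 2) (hε : 0 ≤ ε)
    (hG : openWidth e α G ≤ ENNReal.ofReal ε) (x : 𝕏) {v : 𝕏} (hv : (inner ℝ v e : ℝ) = 0) :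
    |potential e α G (x + v) - potential e α G x| ≤ 2 * α * ‖v‖ := by
  have key : ∀ (x v : 𝕏), (inner ℝ v e : ℝ) = 0 →
      potential e α G x ≤ potential e α G (x + v) + 2 * α * ‖v‖ := by
    intro x v hv
    have h3 := potential_mono_cone he h0 (by linarith) hε hG x (add_smul_mem_coneSet he h0 h1 hv)
    have h4 := potential_add_smul_le he h0 (by linarith) hε hG (x + v)
      (t := 2 * α * ‖v‖) (by positivity)
    rw [← add_assoc] at h3
    linarith
  rw [abs_le]
  have h3 := key x v hv
  have h4 := key (x + v) (-v) (by simp [hv])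
  rw [add_neg_cancel_right, norm_neg] at h4
  constructor <;> linarith

theorem perp_decomp (he : ‖e‖ = 1) (v : 𝕏) : ∃ (t : ℝ) (w : 𝕏), v = t • e + w ∧
    (inner ℝ w e : ℝ) = 0 ∧ t = inner ℝ v e ∧ |t| ≤ ‖v‖ ∧ ‖w‖ ≤ ‖v‖ := by
  have hin : (inner ℝ (v - (inner ℝ v e : ℝ) • e) e : ℝ) = 0 := by
    rw [inner_sub_left, real_inner_smul_left, real_inner_self_eq_norm_sq, he]; ring
  refine ⟨inner ℝ v e, v - (inner ℝ v e : ℝ) • e, by simp, hin, rfl, ?_, ?_⟩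
  · simpa [he] using abs_real_inner_le_norm v e
  · have h1 : ‖v‖ ^ 2 = ‖v - (inner ℝ v e : ℝ) • e‖ ^ 2 + (inner ℝ v e : ℝ) ^ 2 := by
      conv_lhs => rw [← sub_add_cancel v ((inner ℝ v e : ℝ) • e)]
      rw [norm_add_sq_real, real_inner_smul_right, hin, norm_smul, he]
      simp
    exact (pow_le_pow_iff_left₀ (norm_nonneg _) (norm_nonneg _) two_ne_zero).1 (by nlinarith [sq_nonneg (inner ℝ v e : ℝ)])

theorem potential_lipschitz (he : ‖e‖ = 1) (h0 : 0 ≤ α) (h1 : α ≤ 1 / 2) (hε : 0 ≤ ε)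
    (hG : openWidth e α G ≤ ENNReal.ofReal ε) (x v : 𝕏) :
    |potential e α G (x + v) - potential e α G x| ≤ (1 + 2 * α) * ‖v‖ := by
  obtain ⟨t, w, rfl, hw, -, ht, hwv⟩ := perp_decomp he v
  have h2 := potential_perp he h0 h1 hε hG (x + t • e) hw
  have h3 : |potential e α G (x + t • e) - potential e α G x| ≤ |t| := by
    have key : ∀ (x : 𝕏) (t : ℝ), 0 ≤ t →
        |potential e α G (x + t • e) - potential e α G x| ≤ t := by
      intro x t ht
      have h4 := potential_add_smul_le he h0 (by linarith) hε hG x ht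
      have h5 := potential_mono_cone he h0 (by linarith) hε hG x
        (smul_mem_coneSet_self (e := e) (by linarith) ht)
      rw [abs_le]; constructor <;> linarith
    rcases le_total 0 t with h | h
    · rw [abs_of_nonneg h]; exact key x t h
    · rw [abs_of_nonpos h, abs_sub_comm]
      have := key (x + t • e) (-t) (by linarith)
      rwa [neg_smul, add_neg_cancel_right] at this
  rw [← add_assoc]
  have h6 := abs_sub_le (potential e α G (x + t • e + w)) (potential e α G (x + t • e))
    (potential e α G x)
  have h7 : 2 * α * ‖w‖ ≤ 2 * α * ‖t • e + w‖ := by gcongr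
  linarith

theorem potential_in_ball (he : ‖e‖ = 1) (h0 : 0 ≤ α) (h1 : α ≤ 1 / 2) (hε : 0 ≤ ε)
    (hG : openWidth e α G ≤ ENNReal.ofReal ε) {x v : 𝕏}
    (hx : Metric.closedBall x ‖v‖ ⊆ G) :
    |potential e α G (x + v) - potential e α G x - inner ℝ v e| ≤ 2 * α * ‖v‖ := by
  obtain ⟨t, w, hv, hw, hte, ht, hwv⟩ := perp_decomp he v
  have h2 := potential_perp he h0 h1 hε hG (x + t • e) hw
  have hmem : ∀ s : ℝ, |s| ≤ ‖v‖ → x + s • e ∈ G := by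
    intro s hs
    apply hx
    simpa [norm_smul, he] using hs
  have h3 : potential e α G (x + t • e) - potential e α G x = t := by
    have key : ∀ (x : 𝕏) (t : ℝ), 0 ≤ t → (∀ s ∈ Icc 0 t, x + s • e ∈ G) →
        potential e α G (x + t • e) - potential e α G x = t := by
      intro x t ht hs
      have h4 := potential_add_smul_le he h0 (by linarith) hε hG x ht
      have h5 := potential_add_smul_ge he h0 (by linarith) hε hG x hs
      linarith
    rcases le_total 0 t with h | h
    · exact key x t h fun s hs => hmem s (by
        rw [abs_of_nonneg hs.1]; exact hs.2.trans ((le_abs_self t).trans ht))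
    · have := key (x + t • e) (-t) (by linarith) (fun s hs => by
        rw [add_assoc, ← add_smul]
        apply hmem
        rw [abs_of_nonpos (by linarith [hs.2])]
        rw [abs_of_nonpos h] at ht
        linarith [hs.1])
      rw [neg_smul, add_neg_cancel_right] at this
      linarith
  rw [← hte]
  have h6 : potential e α G (x + v) - potential e α G x - t =
      potential e α G (x + t • e + w) - potential e α G (x + t • e) := by
    rw [hv, ← add_assoc]; linarith
  rw [h6]
  exact h2.trans (by gcongr)

end potential

/-- Mollification of a Lipschitz function at scale `ρ`, with pointwise control of the distance of
increments to a given linear functional. -/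
theorem exists_mollification {g : 𝕏 → ℝ} {K : ℝ≥0} (hg : LipschitzWith K g) {ρ : ℝ} (hρ : 0 < ρ) :
    ∃ h : 𝕏 → ℝ, ContDiff ℝ 1 h ∧
      (∀ M, (∀ x, |g x| ≤ M) → ∀ x, |h x| ≤ M) ∧
      (∀ (ℓ : 𝕏 →L[ℝ] ℝ) (x v : 𝕏) (B : ℝ),
        (∀ t ∈ Metric.ball (0 : 𝕏) ρ, |g (x - t + v) - g (x - t) - ℓ v| ≤ B) →
          |h (x + v) - h x - ℓ v| ≤ B) := by
  let φ : ContDiffBump (0 : 𝕏) := ⟨ρ / 2, ρ, by positivity, by linarith⟩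
  set k : 𝕏 → ℝ := φ.normed volume with hk
  have hkc : HasCompactSupport k := φ.hasCompactSupport_normed
  have hk1 : ∫ t, k t = 1 := φ.integral_normed
  have hk0 : ∀ t, 0 ≤ k t := φ.nonneg_normed
  have hkcont : Continuous k := φ.continuous_normed
  have hksupp : ∀ t, t ∉ Metric.ball (0 : 𝕏) ρ → k t = 0 := by
    intro t ht
    have : t ∉ Function.support k := by rw [hk, φ.support_normed_eq]; exact ht
    simpa using this
  have hint : ∀ u : 𝕏 → ℝ, Continuous u → Integrable (fun t => k t * u t) := fun u hu =>
    (hkcont.mul hu).integrable_of_hasCompactSupport hkc.mul_right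
  have hbd : ∀ (u : 𝕏 → ℝ) (B : ℝ), (∀ t ∈ Metric.ball (0 : 𝕏) ρ, |u t| ≤ B) →
      |∫ t, k t * u t| ≤ B := by
    intro u B hB
    calc |∫ t, k t * u t| ≤ ∫ t, k t * B := by
          rw [← Real.norm_eq_abs]
          refine norm_integral_le_of_norm_le (hint (fun _ => B) continuous_const) ?_
          refine Eventually.of_forall fun t => ?_
          rw [norm_mul, Real.norm_eq_abs, Real.norm_eq_abs, abs_of_nonneg (hk0 t)]
          by_cases ht : t ∈ Metric.ball (0 : 𝕏) ρ
          · exact mul_le_mul_of_nonneg_left (hB t ht) (hk0 t)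
          · simp [hksupp t ht]
      _ = B := by rw [integral_mul_const, hk1, one_mul]
  refine ⟨convolution k g (ContinuousLinearMap.lsmul ℝ ℝ) volume, ?_, ?_, ?_⟩
  · exact hkc.contDiff_convolution_left _ φ.contDiff_normed hg.continuous.locallyIntegrable
  · intro M hM x
    simp only [convolution_def, ContinuousLinearMap.lsmul_apply, smul_eq_mul]
    exact hbd (fun t => g (x - t)) M fun t _ => hM _
  · intro ℓ x v B hB
    simp only [convolution_def, ContinuousLinearMap.lsmul_apply, smul_eq_mul]
    have hc : ∀ y : 𝕏, Continuous fun t => g (y - t) := fun y =>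
      hg.continuous.comp (continuous_const.sub continuous_id)
    have h1 : ℓ v = ∫ t, k t * ℓ v := by rw [integral_mul_const, hk1, one_mul]
    have h3 := integral_sub ((hint _ (hc (x + v))).sub (hint _ (hc x)))
      (hint (fun _ => ℓ v) continuous_const)
    simp only [Pi.sub_apply] at h3
    rw [h1, ← integral_sub (hint _ (hc _)) (hint _ (hc _)), ← h3]
    have h2 : ∀ t, k t * g (x + v - t) - k t * g (x - t) - k t * ℓ v =
        k t * (g (x - t + v) - g (x - t) - ℓ v) := by
      intro t
      rw [sub_add_eq_add_sub]; ring
    simp only [h2]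
    exact hbd _ B hB

theorem norm_fderiv_sub_le {h : 𝕏 → ℝ} (hh : Differentiable ℝ h) {ℓ : 𝕏 →L[ℝ] ℝ} {x : 𝕏} {C : ℝ}
    (hC : 0 ≤ C) (H : ∀ᶠ v in 𝓝 (0 : 𝕏), |h (x + v) - h x - ℓ v| ≤ C * ‖v‖) :
    ‖fderiv ℝ h x - ℓ‖ ≤ C := by
  have h1 : HasFDerivAt (fun y => h y - ℓ y) (fderiv ℝ h x - ℓ) x :=
    (hh x).hasFDerivAt.sub ℓ.hasFDerivAt
  refine h1.le_of_lip' hC ?_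
  have h2 : Tendsto (fun y => y - x) (𝓝 x) (𝓝 0) := by
    have : Tendsto (fun y => y - x) (𝓝 x) (𝓝 (x - x)) := tendsto_id.sub tendsto_const_nhds
    rwa [sub_self] at this
  filter_upwards [h2.eventually H] with y hy
  rw [add_sub_cancel] at hy
  rw [Real.norm_eq_abs]
  convert hy using 2
  rw [map_sub]; ring

theorem exists_smooth_potential {e : 𝕏} {α ε : ℝ} {G C : Set 𝕏} (he : ‖e‖ = 1) (h0 : 0 ≤ α)
    (h1 : α ≤ 1 / 2) (hε : 0 ≤ ε) (hG : openWidth e α G ≤ ENNReal.ofReal ε) (hGo : IsOpen G)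
    (hC : IsCompact C) (hCG : C ⊆ G) :
    ∃ ω : 𝕏 → ℝ, ContDiff ℝ 1 ω ∧ (∀ x, |ω x| ≤ ε) ∧ (∀ x, ‖fderiv ℝ ω x‖ ≤ 1 + 2 * α) ∧
      ∀ x ∈ C, ‖fderiv ℝ ω x - innerSL ℝ e‖ ≤ 2 * α := by
  obtain ⟨δ, hδ, hδG⟩ := hC.exists_cthickening_subset_open hGo hCG
  have hlip : LipschitzWith (Real.toNNReal (1 + 2 * α)) (potential e α G) := by
    apply LipschitzWith.of_dist_le_mul
    intro x y
    have := potential_lipschitz he h0 h1 hε hG y (x - y)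
    rwa [add_sub_cancel, ← Real.dist_eq, ← dist_eq_norm,
      ← Real.coe_toNNReal (1 + 2 * α) (by linarith)] at this
  obtain ⟨h, hh, hM, hl⟩ := exists_mollification hlip (half_pos hδ)
  refine ⟨h, hh, hM ε ?_, ?_, ?_⟩
  · intro x
    rw [abs_of_nonneg (potential_nonneg he h0 (by linarith) hε hG x)]
    exact potential_le he h0 (by linarith) hε hG x
  · intro x
    have := norm_fderiv_sub_le (hh.differentiable one_ne_zero) (ℓ := 0) (x := x)
      (C := 1 + 2 * α) (by linarith) (Eventually.of_forall fun v => hl 0 x v _ fun t _ => by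
        simpa using potential_lipschitz he h0 h1 hε hG (x - t) v)
    simpa using this
  · intro x hx
    refine norm_fderiv_sub_le (hh.differentiable one_ne_zero) (by linarith) ?_
    filter_upwards [Metric.ball_mem_nhds (0 : 𝕏) (half_pos hδ)] with v hv
    refine hl _ x v _ fun t ht => ?_
    rw [innerSL_apply_apply, real_inner_comm]
    refine potential_in_ball he h0 h1 hε hG ?_
    refine Subset.trans ?_ ((Metric.closedBall_subset_cthickening hx δ).trans hδG)
    refine Metric.closedBall_subset_closedBall' ?_
    simp only [Metric.mem_ball, dist_zero_right] at hv ht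
    have : dist (x - t) x = ‖t‖ := by simp
    linarith

/-- A smooth function which is `1` on a compact set and supported in a given open set. -/
theorem exists_contDiff_cutoff {C O : Set 𝕏} (hC : IsClosed C) (hO : IsOpen O) (hCO : C ⊆ O) :
    ∃ χ : 𝕏 → ℝ, ContDiff ℝ 1 χ ∧ (∀ x, 0 ≤ χ x) ∧ (∀ x, χ x ≤ 1) ∧ (∀ x ∈ C, χ x = 1) ∧
      tsupport χ ⊆ O := by
  obtain ⟨f, hf0, hf1, hf⟩ := exists_contMDiffMap_zero_one_nhds_of_isClosed (n := 1)
    (modelWithCornersSelf ℝ 𝕏) hO.isClosed_compl hC (disjoint_compl_left_iff_subset.2 hCO)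
  refine ⟨f, f.contMDiff.contDiff, fun x => (hf x).1, fun x => (hf x).2,
    fun x hx => hf1.self_of_nhdsSet x hx, ?_⟩
  intro x hx
  by_contra hxO
  have : ∀ᶠ y in 𝓝 x, f y = 0 := hf0.filter_mono (nhds_le_nhdsSet hxO)
  exact (notMem_tsupport_iff_eventuallyEq.2 this) hx

theorem exists_openWidth_le {e : 𝕏} {α : ℝ} (he : e ≠ 0) (hα : α ≤ 1) {A : Set 𝕏}
    (hA : width e α A = 0) {ε : ℝ} (hε : 0 < ε) :
    ∃ G, IsOpen G ∧ A ⊆ G ∧ openWidth e α G ≤ ENNReal.ofReal ε := by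
  rw [width, if_neg (by push Not; exact ⟨he, hα⟩)] at hA
  have : (⨅ (G : Set 𝕏) (_ : IsOpen G) (_ : A ⊆ G), openWidth e α G) < ENNReal.ofReal ε := by
    rw [hA]; simpa using hε
  simp only [iInf_lt_iff] at this
  obtain ⟨G, h1, h2, h3⟩ := this
  exact ⟨G, h1, h2, h3.le⟩

theorem fderiv_eq_zero_of_notMem_tsupport {u : 𝕏 → ℝ} {x : 𝕏} (hx : x ∉ tsupport u) :
    fderiv ℝ u x = 0 := by
  have h : u =ᶠ[𝓝 x] fun _ => 0 := notMem_tsupport_iff_eventuallyEq.1 hx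
  rw [h.fderiv_eq]; simp

/-- A perturbation whose gradient on `E` is approximately `ψ • e`. -/
theorem exists_perturbation {E B O : Set 𝕏} {e : 𝕏} {α ε : ℝ} {ψ : 𝕏 → ℝ} (he : ‖e‖ = 1)
    (h0 : 0 ≤ α) (h1 : α ≤ 1 / 2) (hε : 0 < ε) (hw : width e α (B ∩ E) = 0)
    (hψ : ContDiff ℝ 1 ψ) (hψ0 : ∀ x, 0 ≤ ψ x) (hψc : HasCompactSupport ψ)
    (hψB : tsupport ψ ⊆ B) (hψE : IsCompact (tsupport ψ ∩ E)) (hO : IsOpen O) (hEO : E ⊆ O) :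
    ∃ u : 𝕏 → ℝ, ContDiff ℝ 1 u ∧ tsupport u ⊆ O ∩ tsupport ψ ∧ (∀ x, |u x| ≤ ε) ∧
      (∀ x, ‖fderiv ℝ u x‖ ≤ 2 * ψ x + ε) ∧
      ∀ x ∈ E, ‖fderiv ℝ u x - ψ x • innerSL ℝ e‖ ≤ 2 * α * ψ x + ε := by
  obtain ⟨χ, hχ, hχ0, hχ1, hχC, hχO⟩ := exists_contDiff_cutoff hψE.isClosed hO
    (inter_subset_right.trans hEO)
  set Φ : 𝕏 → ℝ := fun x => χ x * ψ x with hΦ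
  have hΦd : ContDiff ℝ 1 Φ := hχ.mul hψ
  have hΦc : HasCompactSupport Φ := hψc.mul_left
  have hΦ0 : ∀ x, 0 ≤ Φ x := fun x => mul_nonneg (hχ0 x) (hψ0 x)
  have hΦψ : ∀ x, Φ x ≤ ψ x := fun x => mul_le_of_le_one_left (hψ0 x) (hχ1 x)
  obtain ⟨M₁, hM₁⟩ := hΦc.exists_bound_of_continuous hΦd.continuous
  obtain ⟨M₂, hM₂⟩ := (hΦc.fderiv ℝ).exists_bound_of_continuous
    (hΦd.continuous_fderiv one_ne_zero)
  have hM₁0 : 0 ≤ M₁ := (norm_nonneg _).trans (hM₁ 0)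
  have hM₂0 : 0 ≤ M₂ := (norm_nonneg _).trans (hM₂ 0)
  set ε' : ℝ := ε / (1 + M₁ + M₂) with hε'
  have hε'0 : 0 < ε' := by positivity
  have hε'1 : ε' * M₁ ≤ ε := by
    rw [hε', div_mul_eq_mul_div, div_le_iff₀ (by positivity)]; nlinarith
  have hε'2 : ε' * M₂ ≤ ε := by
    rw [hε', div_mul_eq_mul_div, div_le_iff₀ (by positivity)]; nlinarith
  have hene : e ≠ 0 := by rintro rfl; simp at he
  obtain ⟨G, hGo, hBG, hG⟩ := exists_openWidth_le hene (by linarith) hw hε'0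
  obtain ⟨ω, hω, hωε, hωd, hωC⟩ := exists_smooth_potential he h0 h1 hε'0.le hG hGo hψE
    ((inter_subset_inter_left _ hψB).trans hBG)
  have hder : ∀ x, fderiv ℝ (fun x => Φ x * ω x) x = Φ x • fderiv ℝ ω x + ω x • fderiv ℝ Φ x :=
    fun x => fderiv_mul (hΦd.differentiable one_ne_zero x) (hω.differentiable one_ne_zero x)
  have hsupp : tsupport (fun x => Φ x * ω x) ⊆ tsupport χ ∩ tsupport ψ :=
    subset_inter ((tsupport_mul_subset_left (f := Φ)).trans tsupport_mul_subset_left)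
      ((tsupport_mul_subset_left (f := Φ)).trans tsupport_mul_subset_right)
  have herr : ∀ x, ‖ω x • fderiv ℝ Φ x‖ ≤ ε := by
    intro x
    rw [norm_smul]
    exact (mul_le_mul (hωε x) (hM₂ x) (norm_nonneg _) hε'0.le).trans hε'2
  refine ⟨fun x => Φ x * ω x, hΦd.mul hω, hsupp.trans (inter_subset_inter_left _ hχO), ?_, ?_, ?_⟩
  · intro x
    rw [abs_mul, mul_comm]
    exact (mul_le_mul (hωε x) (hM₁ x) (abs_nonneg _) hε'0.le).trans hε'1
  · intro x
    rw [hder]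
    refine (norm_add_le _ _).trans (add_le_add ?_ (herr x))
    rw [norm_smul, Real.norm_eq_abs, abs_of_nonneg (hΦ0 x), mul_comm]
    exact mul_le_mul ((hωd x).trans (by linarith)) (hΦψ x) (hΦ0 x) zero_le_two
  · intro x hx
    by_cases hxψ : x ∈ tsupport ψ
    · have hxC : x ∈ tsupport ψ ∩ E := ⟨hxψ, hx⟩
      have hΦx : Φ x = ψ x := by simp [hΦ, hχC x hxC]
      rw [hder, hΦx, add_sub_right_comm, ← smul_sub]
      refine (norm_add_le _ _).trans (add_le_add ?_ (herr x))
      rw [norm_smul, Real.norm_eq_abs, abs_of_nonneg (hψ0 x), mul_comm]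
      exact mul_le_mul_of_nonneg_right (hωC x hxC) (hψ0 x)
    · rw [fderiv_eq_zero_of_notMem_tsupport (fun h => hxψ (hsupp h).2),
        image_eq_zero_of_notMem_tsupport hxψ]
      simpa using hε.le

/-- Finite sums of the perturbations from `exists_perturbation`. -/
theorem exists_perturbation_sum {ι : Type*} (J : Finset ι) {E O : Set 𝕏} {B : ι → Set 𝕏}
    {e : ι → 𝕏} {α ε : ℝ} {ψ : ι → 𝕏 → ℝ} (he : ∀ j ∈ J, ‖e j‖ = 1)
    (h0 : 0 ≤ α) (h1 : α ≤ 1 / 2) (hε : 0 < ε) (hw : ∀ j ∈ J, width (e j) α (B j ∩ E) = 0)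
    (hψ : ∀ j ∈ J, ContDiff ℝ 1 (ψ j)) (hψ0 : ∀ j ∈ J, ∀ x, 0 ≤ ψ j x)
    (hψc : ∀ j ∈ J, HasCompactSupport (ψ j)) (hψB : ∀ j ∈ J, tsupport (ψ j) ⊆ B j)
    (hψE : ∀ j ∈ J, IsCompact (tsupport (ψ j) ∩ E)) (hO : IsOpen O) (hEO : E ⊆ O) :
    ∃ u : 𝕏 → ℝ, ContDiff ℝ 1 u ∧ tsupport u ⊆ O ∩ ⋃ j ∈ J, tsupport (ψ j) ∧ (∀ x, |u x| ≤ ε) ∧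
      (∀ x, ‖fderiv ℝ u x‖ ≤ 2 * ∑ j ∈ J, ψ j x + ε) ∧
      ∀ x ∈ E, ‖fderiv ℝ u x - innerSL ℝ (∑ j ∈ J, ψ j x • e j)‖ ≤
        2 * α * ∑ j ∈ J, ψ j x + ε := by
  classical
  induction J using Finset.induction_on generalizing ε with
  | empty =>
    refine ⟨fun _ => 0, contDiff_const, ?_, by simpa using hε.le, by simpa using hε.le,
      by simpa using fun _ _ => hε.le⟩
    simp [tsupport]
  | insert i J hi ih =>
    obtain ⟨u, hu, hus, hue, hud, huE⟩ := ih (ε := ε / 2)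
      (fun j hj => he j (Finset.mem_insert_of_mem hj)) (half_pos hε)
      (fun j hj => hw j (Finset.mem_insert_of_mem hj))
      (fun j hj => hψ j (Finset.mem_insert_of_mem hj))
      (fun j hj => hψ0 j (Finset.mem_insert_of_mem hj))
      (fun j hj => hψc j (Finset.mem_insert_of_mem hj))
      (fun j hj => hψB j (Finset.mem_insert_of_mem hj))
      (fun j hj => hψE j (Finset.mem_insert_of_mem hj))
    have hii := Finset.mem_insert_self i J
    obtain ⟨v, hv, hvs, hve, hvd, hvE⟩ := exists_perturbation (he i hii) h0 h1 (half_pos hε)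
      (hw i hii) (hψ i hii) (hψ0 i hii) (hψc i hii) (hψB i hii) (hψE i hii) hO hEO
    have hder : ∀ x, fderiv ℝ (fun x => v x + u x) x = fderiv ℝ v x + fderiv ℝ u x := fun x =>
      fderiv_add (hv.differentiable one_ne_zero x) (hu.differentiable one_ne_zero x)
    refine ⟨fun x => v x + u x, hv.add hu, ?_, ?_, ?_, ?_⟩
    · refine (tsupport_add v u).trans (union_subset ?_ ?_)
      · refine hvs.trans (inter_subset_inter_right _ ?_)
        exact subset_biUnion_of_mem (u := fun j => tsupport (ψ j)) hii
      · refine hus.trans (inter_subset_inter_right _ ?_)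
        exact biUnion_subset_biUnion_left fun j hj => Finset.mem_insert_of_mem hj
    · intro x
      have := abs_add_le (v x) (u x)
      linarith [hve x, hue x]
    · intro x
      rw [hder, Finset.sum_insert hi]
      have := norm_add_le (fderiv ℝ v x) (fderiv ℝ u x)
      linarith [hvd x, hud x]
    · intro x hx
      rw [hder, Finset.sum_insert hi, Finset.sum_insert hi, map_add, add_sub_add_comm, map_smul]
      have := norm_add_le (fderiv ℝ v x - ψ i x • innerSL ℝ (e i))
        (fderiv ℝ u x - innerSL ℝ (∑ j ∈ J, ψ j x • e j))
      linarith [hvE x hx, huE x hx]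

/-- The difference quotients of `f` at `x` in the direction `y` oscillate by at least `a`. -/
def Oscillates (f : 𝕏 → ℝ) (x y : 𝕏) (a : ℝ) : Prop :=
  ∀ η : ℝ, 0 < η → ∀ ρ : ℝ, 0 < ρ → ∃ t ∈ Ioo 0 ρ, ∃ t' ∈ Ioo 0 ρ,
    a - η ≤ (f (x + t • y) - f x) / t - (f (x + t' • y) - f x) / t'

/-- A scale at which a `C¹` function with compact support is uniformly almost linear. -/
theorem exists_linear_scale {h : 𝕏 → ℝ} (hh : ContDiff ℝ 1 h) (hc : HasCompactSupport h) {ε : ℝ}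
    (hε : 0 < ε) : ∃ t : ℝ, 0 < t ∧ ∀ x z : 𝕏, ‖z - x‖ ≤ t →
      |h z - h x - fderiv ℝ h x (z - x)| ≤ ε * ‖z - x‖ := by
  have hu : UniformContinuous (fderiv ℝ h) :=
    (hc.fderiv ℝ).uniformContinuous_of_continuous (hh.continuous_fderiv one_ne_zero)
  obtain ⟨δ, hδ, H⟩ := Metric.uniformContinuous_iff.1 hu ε hε
  refine ⟨δ / 2, half_pos hδ, fun x z hz => ?_⟩
  refine Convex.norm_image_sub_le_of_norm_fderiv_le' (s := Metric.ball x δ)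
    (fun w _ => hh.differentiable one_ne_zero w) (fun w hw => ?_) (convex_ball x δ)
    (Metric.mem_ball_self hδ) ?_
  · rw [← dist_eq_norm]; exact (H hw).le
  · rw [Metric.mem_ball, dist_eq_norm]; linarith

theorem quotient_approx {f g : 𝕏 → ℝ} {ℓ : 𝕏 →L[ℝ] ℝ} {x y : 𝕏} {t κ : ℝ} (ht : 0 < t)
    (hκ : 0 ≤ κ) (hfg : ∀ z, |f z - g z| ≤ κ * t)
    (hg : ∀ z, ‖z - x‖ ≤ t → |g z - g x - ℓ (z - x)| ≤ κ * ‖z - x‖) :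
    |(f (x + (t / (1 + ‖y‖)) • y) - f x) / (t / (1 + ‖y‖)) - ℓ y| ≤ κ * (3 * (1 + ‖y‖)) := by
  have hy : 0 < 1 + ‖y‖ := by positivity
  set s := t / (1 + ‖y‖) with hs
  have hs0 : 0 < s := by positivity
  have hst : s * (1 + ‖y‖) = t := div_mul_cancel₀ _ hy.ne'
  have hsy : ‖x + s • y - x‖ = s * ‖y‖ := by
    rw [add_sub_cancel_left, norm_smul, Real.norm_eq_abs, abs_of_pos hs0]
  have h1 := hg (x + s • y) (by rw [hsy]; nlinarith)
  rw [hsy, add_sub_cancel_left, map_smul, smul_eq_mul] at h1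
  have h2 := hfg (x + s • y)
  have h3 := hfg x
  have h4 : |f (x + s • y) - f x - s * ℓ y| ≤ κ * (3 * (1 + ‖y‖)) * s := by
    rw [abs_le] at *
    rw [← hst] at h2 h3
    have : κ * (s * ‖y‖) ≤ κ * (s * (1 + ‖y‖)) := by gcongr; linarith
    constructor <;> nlinarith
  have h5 : (f (x + s • y) - f x) / s - ℓ y = (f (x + s • y) - f x - s * ℓ y) / s := by
    field_simp
  rw [h5, abs_div, abs_of_pos hs0, div_le_iff₀ hs0]
  exact h4

theorem exists_separation {K U : Set 𝕏} (hK : IsCompact K) (hU : IsOpen U) (hKU : K ⊆ U) :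
    ∃ d : ℝ, 0 < d ∧ ∀ z ∈ K, ∀ x ∉ U, d ≤ ‖z - x‖ := by
  obtain ⟨d, hd, H⟩ := hK.exists_thickening_subset_open hU hKU
  refine ⟨d, hd, fun z hz x hx => ?_⟩
  by_contra! h
  refine hx (H (Metric.mem_thickening_iff.2 ⟨z, hz, ?_⟩))
  rwa [dist_comm, dist_eq_norm]

theorem sum_half_pow_le (m : ℕ) : ∑ j ∈ Finset.range m, (1 / 2 : ℝ) ^ (j + 3) ≤ 1 / 4 := by
  have h : ∑ j ∈ Finset.range m, (1 / 2 : ℝ) ^ (j + 3) = 1 / 4 - (1 / 2) ^ (m + 2) := by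
    induction m with
    | zero => norm_num
    | succ m ih => rw [Finset.sum_range_succ, ih]; ring
  rw [h]
  have : (0 : ℝ) < (1 / 2) ^ (m + 2) := by positivity
  linarith

/-- One stage of the construction: switching a perturbation on at the scale `t` and off at the
scale `t'`. -/
theorem toggle_step {E F : Set 𝕏} (hEF : E ⊆ F) {Ψ : 𝕏 → 𝕏} {b B : 𝕏 → ℝ} {K : Set 𝕏}
    (hstep : ∀ O, IsOpen O → E ⊆ O → ∀ ε : ℝ, 0 < ε → ε ≤ 1 → ∃ u : 𝕏 → ℝ, ContDiff ℝ 1 u ∧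
      tsupport u ⊆ O ∩ K ∧ (∀ x, |u x| ≤ ε) ∧ (∀ x, ‖fderiv ℝ u x‖ ≤ 3) ∧
      ∀ x ∈ E, ‖fderiv ℝ u x - innerSL ℝ (Ψ x)‖ ≤ b x + ε)
    (hK : IsCompact K) {d : ℝ} (hd : 0 < d) (m : ℕ) {f : 𝕏 → ℝ} {t : ℝ} (hf : ContDiff ℝ 1 f)
    (hfc : HasCompactSupport f) (hf8 : ∀ x, ‖fderiv ℝ f x‖ ≤ 8)
    (hfE : ∀ x ∈ E, ‖fderiv ℝ f x‖ ≤ B x) (hB : ∀ x ∈ E, B x < 1) (ht : 0 < t) :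
    ∃ (f' : 𝕏 → ℝ) (t' : ℝ) (h : 𝕏 → ℝ) (s : ℝ),
      (ContDiff ℝ 1 f' ∧ HasCompactSupport f' ∧ (∀ x, ‖fderiv ℝ f' x‖ ≤ 8) ∧
        (∀ x ∈ E, ‖fderiv ℝ f' x‖ ≤ B x + (2 * b x + (1 / 2) ^ (m + 3))) ∧ 0 < t' ∧
        t' ≤ (1 / 2) ^ (m + 1) ∧
        ∀ x z, ‖z - x‖ ≤ t' →
          |f' z - f' x - fderiv ℝ f' x (z - x)| ≤ (1 / 2) ^ (m + 1) * ‖z - x‖) ∧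
      0 < s ∧ t' ≤ s ∧ s ≤ t ∧
      (∀ x, |f' x - f x| ≤ (1 / 2) ^ (m + 3) * t) ∧
      (∀ x, |f' x - f x| ≤ (1 / 2) ^ (m + 3) * d ^ 2) ∧
      (∀ x, |f' x - h x| ≤ (1 / 2) ^ (m + 3) * s) ∧
      (∀ x z, ‖z - x‖ ≤ s → |h z - h x - fderiv ℝ h x (z - x)| ≤ (1 / 2) ^ m * ‖z - x‖) ∧
      (∀ x ∈ E, ‖fderiv ℝ h x - fderiv ℝ f x - innerSL ℝ (Ψ x)‖ ≤ b x + (1 / 2) ^ m) ∧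
      (∀ x, f' x ≠ f x → x ∈ K ∧ x ∈ Metric.thickening ((1 / 2) ^ m) F) := by
  set O : Set 𝕏 := {x | ‖fderiv ℝ f x‖ < 1} ∩ Metric.thickening ((1 / 2) ^ m) F with hO
  have hOo : IsOpen O := (isOpen_lt (hf.continuous_fderiv one_ne_zero).norm continuous_const).inter
    Metric.isOpen_thickening
  have hEO : E ⊆ O := fun x hx => ⟨(hfE x hx).trans_lt (hB x hx),
    Metric.self_subset_thickening (by positivity) F (hEF hx)⟩
  have hp : (0 : ℝ) < (1 / 2) ^ (m + 4) := by positivity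
  have hp1 : ((1 : ℝ) / 2) ^ (m + 4) ≤ 1 := pow_le_one₀ (by norm_num) (by norm_num)
  have hp3 : ((1 : ℝ) / 2) ^ (m + 3) = 2 * (1 / 2) ^ (m + 4) := by ring
  have hp0 : ((1 : ℝ) / 2) ^ (m + 4) ≤ (1 / 2) ^ m :=
    pow_le_pow_of_le_one (by norm_num) (by norm_num) (by omega)
  have hmin : ∀ r : ℝ, 0 < r → ∃ ε : ℝ, 0 < ε ∧ ε ≤ 1 ∧ ε ≤ (1 / 2) ^ (m + 4) ∧
      ε ≤ (1 / 2) ^ (m + 4) * r ∧ ε ≤ (1 / 2) ^ (m + 4) * d ^ 2 := by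
    intro r hr
    refine ⟨(1 / 2) ^ (m + 4) * min 1 (min r (d ^ 2)), by positivity, ?_, ?_, ?_, ?_⟩
    · exact mul_le_one₀ hp1 (by positivity) (min_le_left _ _)
    · exact mul_le_of_le_one_right hp.le (min_le_left _ _)
    · exact mul_le_mul_of_nonneg_left ((min_le_right _ _).trans (min_le_left _ _)) hp.le
    · exact mul_le_mul_of_nonneg_left ((min_le_right _ _).trans (min_le_right _ _)) hp.le
  obtain ⟨ε, hε, hε1, hεp, hεt, hεd⟩ := hmin t ht
  obtain ⟨u, hu, hus, hue, hu3, huE⟩ := hstep O hOo hEO ε hε hε1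
  have huc : HasCompactSupport u :=
    hK.of_isClosed_subset (isClosed_tsupport u) (hus.trans inter_subset_right)
  have hhd : ∀ x, fderiv ℝ (fun x => f x + u x) x = fderiv ℝ f x + fderiv ℝ u x := fun x =>
    fderiv_add (hf.differentiable one_ne_zero x) (hu.differentiable one_ne_zero x)
  obtain ⟨s₀, hs₀, hs⟩ := exists_linear_scale (hf.add hu) (hfc.add huc)
    (ε := (1 / 2) ^ m) (by positivity)
  obtain ⟨s, hs0, hss, hst⟩ : ∃ s, 0 < s ∧ s ≤ s₀ ∧ s ≤ t :=
    ⟨min s₀ t, lt_min hs₀ ht, min_le_left _ _, min_le_right _ _⟩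
  obtain ⟨ε', hε', hε'1, hε'p, hε's, hε'd⟩ := hmin s hs0
  obtain ⟨v, hv, hvs, hve, hv3, hvE⟩ := hstep O hOo hEO ε' hε' hε'1
  have hvc : HasCompactSupport v :=
    hK.of_isClosed_subset (isClosed_tsupport v) (hvs.trans inter_subset_right)
  have hf' : ContDiff ℝ 1 (fun x => f x + u x - v x) := (hf.add hu).sub hv
  have hf'c : HasCompactSupport (fun x => f x + u x - v x) := by
    have := (hfc.add huc).add hvc.neg
    simpa only [Pi.add_def, Pi.neg_def, ← sub_eq_add_neg] using this
  have hf'd : ∀ x, fderiv ℝ (fun x => f x + u x - v x) x =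
      fderiv ℝ f x + fderiv ℝ u x - fderiv ℝ v x := fun x => by
    rw [← hhd]
    exact fderiv_sub ((hf.add hu).differentiable one_ne_zero x) (hv.differentiable one_ne_zero x)
  obtain ⟨r₀, hr₀, hr⟩ := exists_linear_scale hf' hf'c (ε := (1 / 2) ^ (m + 1)) (by positivity)
  have hdiff : ∀ x, |f x + u x - v x - f x| ≤ ε + ε' := fun x => by
    have := abs_sub (u x) (v x)
    rw [show f x + u x - v x - f x = u x - v x by ring]
    linarith [hue x, hve x]
  refine ⟨fun x => f x + u x - v x, min r₀ (min s ((1 / 2) ^ (m + 1))), fun x => f x + u x, s,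
    ⟨hf', hf'c, ?_, ?_, by positivity, (min_le_right _ _).trans (min_le_right _ _), ?_⟩, hs0,
    (min_le_right _ _).trans (min_le_left _ _), hst, ?_, ?_, ?_, ?_, ?_, ?_⟩
  · intro x
    rw [hf'd]
    by_cases hx : x ∈ O
    · have h1 := norm_sub_le (fderiv ℝ f x + fderiv ℝ u x) (fderiv ℝ v x)
      have h2 := norm_add_le (fderiv ℝ f x) (fderiv ℝ u x)
      have h3 : ‖fderiv ℝ f x‖ < 1 := hx.1
      linarith [hu3 x, hv3 x]
    · rw [fderiv_eq_zero_of_notMem_tsupport fun h => hx (hus h).1,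
        fderiv_eq_zero_of_notMem_tsupport fun h => hx (hvs h).1]
      simpa using hf8 x
  · intro x hx
    rw [hf'd]
    have h0 : fderiv ℝ f x + fderiv ℝ u x - fderiv ℝ v x = fderiv ℝ f x +
        (fderiv ℝ u x - innerSL ℝ (Ψ x)) - (fderiv ℝ v x - innerSL ℝ (Ψ x)) := by abel
    rw [h0]
    have h1 := norm_sub_le (fderiv ℝ f x + (fderiv ℝ u x - innerSL ℝ (Ψ x)))
      (fderiv ℝ v x - innerSL ℝ (Ψ x))
    have h2 := norm_add_le (fderiv ℝ f x) (fderiv ℝ u x - innerSL ℝ (Ψ x))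
    linarith [huE x hx, hvE x hx, hfE x hx]
  · intro x z hz
    exact hr x z (hz.trans (min_le_left _ _))
  · intro x
    have : (1 / 2 : ℝ) ^ (m + 4) * s ≤ (1 / 2) ^ (m + 4) * t := by gcongr
    have := hdiff x
    rw [hp3]
    linarith
  · intro x
    have := hdiff x
    rw [hp3]
    linarith
  · intro x
    have h1 : f x + u x - v x - (f x + u x) = - v x := by ring
    have h2 : 0 < (1 / 2 : ℝ) ^ (m + 4) * s := by positivity
    simp only [h1, abs_neg]
    rw [hp3]
    linarith [hve x]
  · intro x z hz
    exact hs x z (hz.trans hss)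
  · intro x hx
    rw [hhd, add_sub_cancel_left]
    linarith [huE x hx]
  · intro x hx
    have : x ∈ O ∩ K := by
      by_contra hxn
      refine hx ?_
      simp only
      rw [image_eq_zero_of_notMem_tsupport fun h => hxn (hus h),
        image_eq_zero_of_notMem_tsupport fun h => hxn (hvs h)]
      ring
    exact ⟨this.2, this.1.2⟩

theorem exists_oscillating {E F U : Set 𝕏} (hF : IsClosed F) (hU : IsOpen U) (hE : E = F ∩ U)
    {Ψ : ℕ → 𝕏 → 𝕏} {b : ℕ → 𝕏 → ℝ} {K : ℕ → Set 𝕏} (hK : ∀ m, IsCompact (K m))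
    (hKU : ∀ m, K m ⊆ U) (hb0 : ∀ m x, 0 ≤ b m x)
    (hb : ∀ M x, ∑ m ∈ Finset.range M, b m x ≤ 1 / 4)
    (hstep : ∀ m O, IsOpen O → E ⊆ O → ∀ ε : ℝ, 0 < ε → ε ≤ 1 → ∃ u : 𝕏 → ℝ, ContDiff ℝ 1 u ∧
      tsupport u ⊆ O ∩ K m ∧ (∀ x, |u x| ≤ ε) ∧ (∀ x, ‖fderiv ℝ u x‖ ≤ 3) ∧
      ∀ x ∈ E, ‖fderiv ℝ u x - innerSL ℝ (Ψ m x)‖ ≤ b m x + ε) :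
    ∃ f : 𝕏 → ℝ, LipschitzWith 8 f ∧ (∀ x, |f x| ≤ 1) ∧ (∀ x ∉ E, DifferentiableAt ℝ f x) ∧
      ∀ x ∈ E, ∀ (y : 𝕏) (a : ℝ), (∃ᶠ m in atTop, a ≤ |(inner ℝ (Ψ m x) y : ℝ)|) →
        Oscillates f x y a := by
  choose d hd hdU using fun m => exists_separation (hK m) hU (hKU m)
  set B : ℕ → 𝕏 → ℝ := fun m x => ∑ j ∈ Finset.range m, (2 * b j x + (1 / 2) ^ (j + 3)) with hBdef
  have hB1 : ∀ m x, B m x < 1 := by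
    intro m x
    simp only [hBdef, Finset.sum_add_distrib, ← Finset.mul_sum]
    linarith [hb m x, sum_half_pow_le m]
  set P : ℕ → (𝕏 → ℝ) × ℝ → Prop := fun m p =>
    ContDiff ℝ 1 p.1 ∧ HasCompactSupport p.1 ∧ (∀ x, ‖fderiv ℝ p.1 x‖ ≤ 8) ∧
      (∀ x ∈ E, ‖fderiv ℝ p.1 x‖ ≤ B m x) ∧ 0 < p.2 ∧ p.2 ≤ (1 / 2) ^ m ∧
      ∀ x z, ‖z - x‖ ≤ p.2 →
        |p.1 z - p.1 x - fderiv ℝ p.1 x (z - x)| ≤ (1 / 2) ^ m * ‖z - x‖ with hP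
  have step : ∀ m p, P m p → ∃ p' q : (𝕏 → ℝ) × ℝ, P (m + 1) p' ∧
      0 < q.2 ∧ p'.2 ≤ q.2 ∧ q.2 ≤ p.2 ∧
      (∀ x, |p'.1 x - p.1 x| ≤ (1 / 2) ^ (m + 3) * p.2) ∧
      (∀ x, |p'.1 x - p.1 x| ≤ (1 / 2) ^ (m + 3) * d m ^ 2) ∧
      (∀ x, |p'.1 x - q.1 x| ≤ (1 / 2) ^ (m + 3) * q.2) ∧
      (∀ x z, ‖z - x‖ ≤ q.2 →
        |q.1 z - q.1 x - fderiv ℝ q.1 x (z - x)| ≤ (1 / 2) ^ m * ‖z - x‖) ∧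
      (∀ x ∈ E, ‖fderiv ℝ q.1 x - fderiv ℝ p.1 x - innerSL ℝ (Ψ m x)‖ ≤ b m x + (1 / 2) ^ m) ∧
      (∀ x, p'.1 x ≠ p.1 x → x ∈ K m ∧ x ∈ Metric.thickening ((1 / 2) ^ m) F) := by
    rintro m ⟨f, t⟩ ⟨h1, h2, h3, h4, h5, h6, -⟩
    obtain ⟨f', t', h, s, ⟨g1, g2, g3, g4, g5, g6, g7⟩, H⟩ := toggle_step
      (hE ▸ inter_subset_left) (hstep m) (hK m) (hd m) m h1 h2 h3 h4 (fun x _ => hB1 m x) h5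
    refine ⟨⟨f', t'⟩, ⟨h, s⟩, ⟨g1, g2, g3, fun x hx => ?_, g5, g6, g7⟩, H⟩
    simp only [hBdef, Finset.sum_range_succ]
    exact g4 x hx
  choose! S Q hS hQ using step
  let p : ℕ → (𝕏 → ℝ) × ℝ := fun m => Nat.rec (fun _ => 0, 1) (fun m p => S m p) m
  have hp0 : p 0 = (fun _ => 0, 1) := rfl
  have hps : ∀ m, p (m + 1) = S m (p m) := fun m => rfl
  have hPp : ∀ m, P m (p m) := by
    intro m
    induction m with
    | zero =>
      refine ⟨contDiff_const, HasCompactSupport.zero, ?_, ?_, ?_, ?_, ?_⟩ <;> simp [hp0, hBdef]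
    | succ m ih => exact hS m _ ih
  have hQp := fun m => hQ m (p m) (hPp m)
  simp only [← hps] at hQp
  clear_value p
  have ht0 : ∀ m, 0 < (p m).2 := fun m => (hPp m).2.2.2.2.1
  have htle : ∀ m, (p m).2 ≤ (1 / 2) ^ m := fun m => (hPp m).2.2.2.2.2.1
  have htanti : Antitone fun m => (p m).2 :=
    antitone_nat_of_succ_le fun m => (hQp m).2.1.trans (hQp m).2.2.1
  have hgeom : ∀ m k x, dist ((p (m + k)).1 x) ((p (m + (k + 1))).1 x) ≤
      (1 / 2) ^ (m + 2) * (p m).2 / 2 / 2 ^ k := by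
    intro m k x
    rw [dist_comm, Real.dist_eq, ← add_assoc]
    refine ((hQp (m + k)).2.2.2.1 x).trans ?_
    calc (1 / 2 : ℝ) ^ (m + k + 3) * (p (m + k)).2 ≤ (1 / 2 : ℝ) ^ (m + k + 3) * (p m).2 := by
          gcongr; exact htanti (Nat.le_add_right m k)
      _ = (1 / 2 : ℝ) ^ (m + 2) * (p m).2 / 2 / 2 ^ k := by
          simp only [one_div, inv_pow, pow_add, pow_succ]; field_simp
  have hlim : ∀ x, ∃ r, Tendsto (fun m => (p m).1 x) atTop (𝓝 r) := by
    intro x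
    refine cauchySeq_tendsto_of_complete (cauchySeq_of_le_geometric_two (C := (1 / 2) ^ 2 * (p 0).2)
      fun k => ?_)
    simpa using hgeom 0 k x
  choose f hf using hlim
  have hfm : ∀ m x, |f x - (p m).1 x| ≤ (1 / 2) ^ (m + 2) * (p m).2 := by
    intro m x
    have h1 : Tendsto (fun k => (p (m + k)).1 x) atTop (𝓝 (f x)) := by
      have := (hf x).comp (tendsto_add_atTop_nat m)
      refine this.congr fun k => ?_
      simp [add_comm]
    have := dist_le_of_le_geometric_two_of_tendsto₀ (fun k => hgeom m k x) h1
    rwa [dist_comm, Real.dist_eq] at this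
  refine ⟨f, ?_, ?_, ?_, ?_⟩
  · have hm : ∀ m, LipschitzWith 8 (p m).1 := fun m =>
      lipschitzWith_of_nnnorm_fderiv_le ((hPp m).1.differentiable one_ne_zero)
        fun x => (hPp m).2.2.1 x
    apply LipschitzWith.of_dist_le_mul
    intro x y
    refine le_of_tendsto ((hf x).dist (hf y)) (Eventually.of_forall fun m => ?_)
    exact (hm m).dist_le_mul x y
  · intro x
    have := hfm 0 x
    rw [hp0] at this
    norm_num at this
    linarith
  · intro x hx
    by_cases hxU : x ∈ U
    · have hxF : x ∉ F := fun h => hx (hE ▸ ⟨h, hxU⟩)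
      obtain ⟨δ, hδ, hδF⟩ := Metric.isOpen_iff.1 hF.isOpen_compl x hxF
      obtain ⟨M, hM⟩ := exists_pow_lt_of_lt_one (half_pos hδ) (by norm_num : (1 / 2 : ℝ) < 1)
      have hout : ∀ z ∈ Metric.ball x (δ / 2), ∀ m, M ≤ m → (p (m + 1)).1 z = (p m).1 z := by
        intro z hz m hm
        by_contra hne
        obtain ⟨w, hwF, hw⟩ := Metric.mem_thickening_iff.1 ((hQp m).2.2.2.2.2.2.2.2 z hne).2
        refine hδF ?_ hwF
        have : (1 / 2 : ℝ) ^ m ≤ (1 / 2) ^ M :=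
          pow_le_pow_of_le_one (by norm_num) (by norm_num) hm
        rw [Metric.mem_ball] at hz ⊢
        have := dist_triangle_left w x z
        linarith
      have hconst : ∀ z ∈ Metric.ball x (δ / 2), f z = (p M).1 z := by
        intro z hz
        have h1 : ∀ k, (p (M + k)).1 z = (p M).1 z := by
          intro k
          induction k with
          | zero => rfl
          | succ k ih => rw [← add_assoc, hout z hz _ (Nat.le_add_right _ _), ih]
        refine tendsto_nhds_unique (hf z) (tendsto_const_nhds.congr' ?_)
        filter_upwards [eventually_ge_atTop M] with m hm
        obtain ⟨k, rfl⟩ := Nat.exists_eq_add_of_le hm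
        exact (h1 k).symm
      refine ((hPp M).1.differentiable one_ne_zero x).congr_of_eventuallyEq ?_
      filter_upwards [Metric.ball_mem_nhds x (half_pos hδ)] with z hz using hconst z hz
    · have hsq : ∀ z, |f z| ≤ 1 / 4 * ‖z - x‖ ^ 2 := by
        intro z
        have h1 : ∀ m, dist ((p m).1 z) ((p (m + 1)).1 z) ≤
            1 / 4 * ‖z - x‖ ^ 2 / 2 / 2 ^ m := by
          intro m
          by_cases hz : (p (m + 1)).1 z = (p m).1 z
          · rw [hz, dist_self]; positivity
          · have hzK := ((hQp m).2.2.2.2.2.2.2.2 z hz).1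
            have hdz := hdU m z hzK x hxU
            rw [dist_comm, Real.dist_eq]
            refine ((hQp m).2.2.2.2.1 z).trans ?_
            calc (1 / 2 : ℝ) ^ (m + 3) * d m ^ 2 ≤ (1 / 2 : ℝ) ^ (m + 3) * ‖z - x‖ ^ 2 := by
                  gcongr; exact (hd m).le
              _ = _ := by
                  simp only [one_div, inv_pow, pow_succ]; ring
        have := dist_le_of_le_geometric_two_of_tendsto₀ h1 (hf z)
        rw [hp0, Real.dist_eq] at this
        simpa using this
      have hfx : f x = 0 := by simpa using hsq x
      refine HasFDerivAt.differentiableAt (f' := 0) ?_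
      rw [hasFDerivAt_iff_isLittleO]
      have : (fun z => f z - f x - (0 : 𝕏 →L[ℝ] ℝ) (z - x)) =O[𝓝 x] fun z => ‖z - x‖ ^ 2 := by
        refine Asymptotics.IsBigO.of_bound (1 / 4) (Eventually.of_forall fun z => ?_)
        simpa [hfx] using hsq z
      refine this.trans_isLittleO ?_
      exact (Asymptotics.isLittleO_norm_pow_id one_lt_two).comp_tendsto (by
        have : Tendsto (fun z => z - x) (𝓝 x) (𝓝 (x - x)) := tendsto_id.sub tendsto_const_nhds
        rwa [sub_self] at this)
  · intro x hx y a ha η hη ρ hρ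
    have hbt : Tendsto (fun m => b m x) atTop (𝓝 0) :=
      (summable_of_sum_range_le (fun m => hb0 m x) (fun M => hb M x)).tendsto_atTop_zero
    have hpt : Tendsto (fun m : ℕ => (1 / 2 : ℝ) ^ m) atTop (𝓝 0) :=
      tendsto_pow_atTop_nhds_zero_of_lt_one (by norm_num) (by norm_num)
    have herr : Tendsto (fun m => (b m x + (1 / 2 : ℝ) ^ m) * ‖y‖ +
        2 * ((1 / 2 : ℝ) ^ m * (3 * (1 + ‖y‖)))) atTop (𝓝 0) := by
      have := ((hbt.add hpt).mul_const ‖y‖).add ((hpt.mul_const (3 * (1 + ‖y‖))).const_mul 2)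
      simpa using this
    obtain ⟨m, ham, hm1, hm2⟩ := (ha.and_eventually
      ((herr.eventually_lt_const hη).and (hpt.eventually_lt_const hρ))).exists
    set q := Q m (p m) with hq
    obtain ⟨hq0, hq1, hq2, -, -, hq3, hq4, hq5, -⟩ := hQp m
    have hpm : 0 < (1 / 2 : ℝ) ^ m := by positivity
    have h23 : ((1 : ℝ) / 2) ^ (m + 2) ≤ (1 / 2) ^ m :=
      pow_le_pow_of_le_one (by norm_num) (by norm_num) (by omega)
    have e1 := quotient_approx (f := f) (y := y) (x := x) (ht0 m) hpm.le
      (fun z => (hfm m z).trans (mul_le_mul_of_nonneg_right h23 (ht0 m).le))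
      (fun z hz => (hPp m).2.2.2.2.2.2 x z hz)
    have e2 := quotient_approx (f := f) (y := y) (x := x) hq0 hpm.le
      (fun z => by
        have i1 := hfm (m + 1) z
        have i2 := hq3 z
        have i3 := abs_sub_le (f z) ((p (m + 1)).1 z) (q.1 z)
        have i4 : ((1 : ℝ) / 2) ^ (m + 1 + 2) * (p (m + 1)).2 ≤ (1 / 2) ^ (m + 3) * q.2 := by
          gcongr
        have i5 : ((1 : ℝ) / 2) ^ (m + 3) * q.2 = 1 / 8 * ((1 / 2) ^ m * q.2) := by ring
        have i6 : 0 < ((1 : ℝ) / 2) ^ m * q.2 := by positivity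
        linarith)
      (fun z hz => hq4 x z hz)
    have hq6 := hq5 x hx
    have hy : 0 < 1 + ‖y‖ := by positivity
    have hs1 : ∀ t : ℝ, 0 < t → t ≤ (p m).2 → t / (1 + ‖y‖) ∈ Ioo 0 ρ := by
      intro t h1 h2
      refine ⟨by positivity, lt_of_le_of_lt ((div_le_self h1.le ?_).trans (h2.trans (htle m))) hm2⟩
      linarith [norm_nonneg y]
    have h7 : |fderiv ℝ q.1 x y - fderiv ℝ (p m).1 x y - inner ℝ (Ψ m x) y| ≤
        (b m x + (1 / 2) ^ m) * ‖y‖ :=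
      ((fderiv ℝ q.1 x - fderiv ℝ (p m).1 x - innerSL ℝ (Ψ m x)).le_opNorm y).trans
        (mul_le_mul_of_nonneg_right hq6 (norm_nonneg y))
    rw [abs_le] at e1 e2 h7
    rcases le_total 0 (inner ℝ (Ψ m x) y : ℝ) with h | h
    · rw [abs_of_nonneg h] at ham
      exact ⟨_, hs1 _ hq0 hq2, _, hs1 _ (ht0 m) le_rfl, by linarith⟩
    · rw [abs_of_nonpos h] at ham
      exact ⟨_, hs1 _ (ht0 m) le_rfl, _, hs1 _ hq0 hq2, by linarith⟩

theorem width_mono {e : 𝕏} {α : ℝ} {A B : Set 𝕏} (h : A ⊆ B) : width e α A ≤ width e α B := by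
  unfold width
  split_ifs
  · exact le_rfl
  · exact iInf_mono fun G => iInf_mono fun _ => iInf_mono' fun hB => ⟨h.trans hB, le_rfl⟩

/-- A partition of unity on an open set, subordinate to given balls, whose members are grouped so
that at every point one of the groups has a sum of at least `1 / 2`. -/
theorem exists_grouped_partition {W : Set 𝕏} (hW : W.Nonempty) {r : 𝕏 → ℝ}
    (hr : ∀ x ∈ W, 0 < r x) (hrW : ∀ x ∈ W, Metric.ball x (r x) ⊆ W) :
    ∃ (ψ : ℕ → 𝕏 → ℝ) (c : ℕ → 𝕏) (N : ℕ → ℕ), (∀ j, c j ∈ W) ∧ N 0 = 0 ∧ StrictMono N ∧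
      (∀ j, ContDiff ℝ 1 (ψ j)) ∧ (∀ j x, 0 ≤ ψ j x) ∧ (∀ j, HasCompactSupport (ψ j)) ∧
      (∀ j, tsupport (ψ j) ⊆ Metric.ball (c j) (r (c j))) ∧
      (∀ M x, ∑ j ∈ Finset.range M, ψ j x ≤ 1) ∧
      ∀ x ∈ W, ∃ i, 1 / 2 ≤ ∑ j ∈ Finset.Ico (N i) (N (i + 1)), ψ j x := by
  obtain ⟨t, htW, htc, hcov⟩ := TopologicalSpace.countable_cover_nhdsWithin
    (f := fun x => Metric.ball x (r x / 4)) (s := W)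
    (fun x hx => mem_nhdsWithin_of_mem_nhds (Metric.ball_mem_nhds x (by linarith [hr x hx])))
  have htne : t.Nonempty := by
    obtain ⟨x, hx⟩ := hW
    obtain ⟨y, hy, -⟩ := mem_iUnion₂.1 (hcov hx)
    exact ⟨y, hy⟩
  obtain ⟨c, rfl⟩ := htc.exists_eq_range htne
  have hcW : ∀ j, c j ∈ W := fun j => htW (mem_range_self j)
  have hrc : ∀ j, 0 < r (c j) := fun j => hr _ (hcW j)
  replace hcov : ∀ x ∈ W, ∃ j, x ∈ Metric.ball (c j) (r (c j) / 4) := fun x hx => by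
    simpa using hcov hx
  let χ : ∀ j, ContDiffBump (c j) := fun j =>
    ⟨r (c j) / 4, r (c j) / 2, by linarith [hrc j], by linarith [hrc j]⟩
  have hχ1 : ∀ j x, x ∈ Metric.ball (c j) (r (c j) / 4) → χ j x = 1 := fun j x hx =>
    (χ j).one_of_mem_closedBall (Metric.ball_subset_closedBall hx)
  have hχt : ∀ j, tsupport (χ j) = Metric.closedBall (c j) (r (c j) / 2) := fun j =>
    (χ j).tsupport_eq
  have hχ0 : ∀ j x, 0 ≤ 1 - χ j x := fun j x => sub_nonneg.2 (χ j).le_one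
  set ψ : ℕ → 𝕏 → ℝ := fun j x => χ j x * ∏ k ∈ Finset.range j, (1 - χ k x) with hψ
  have hsum : ∀ M x, ∑ j ∈ Finset.range M, ψ j x = 1 - ∏ k ∈ Finset.range M, (1 - χ k x) := by
    intro M x
    induction M with
    | zero => simp
    | succ M ih => rw [Finset.sum_range_succ, ih, Finset.prod_range_succ]; simp only [hψ]; ring
  have hψsupp : ∀ j, tsupport (ψ j) ⊆ tsupport (χ j) := fun j => tsupport_mul_subset_left
  have hψ0 : ∀ j x, 0 ≤ ψ j x := fun j x =>
    mul_nonneg (χ j).nonneg (Finset.prod_nonneg fun k _ => hχ0 k x)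
  have hone : ∀ j M x, j < M → χ j x = 1 → ∑ i ∈ Finset.range M, ψ i x = 1 := by
    intro j M x hj hx
    rw [hsum, Finset.prod_eq_zero (Finset.mem_range.2 hj) (by rw [hx, sub_self]), sub_zero]
  have hnext : ∀ M : ℕ, ∃ M', M < M' ∧ ∀ x, (∃ j < M, x ∈ tsupport (χ j)) →
      ∑ i ∈ Finset.range M', ψ i x = 1 := by
    intro M
    have hcomp : IsCompact (⋃ j ∈ Finset.range M, tsupport (χ j)) :=
      (Finset.range M).isCompact_biUnion fun j _ => (χ j).hasCompactSupport
    obtain ⟨J, hJ⟩ := hcomp.elim_finite_subcover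
      (fun j => Metric.ball (c j) (r (c j) / 4)) (fun j => Metric.isOpen_ball) (by
        refine iUnion₂_subset fun j _ x hx => ?_
        rw [hχt] at hx
        have : x ∈ W := hrW _ (hcW j) (Metric.closedBall_subset_ball (by linarith [hrc j]) hx)
        exact mem_iUnion.2 (hcov x this))
    refine ⟨max (M + 1) (J.sup id + 1), by simp, ?_⟩
    rintro x ⟨j, hj, hx⟩
    obtain ⟨k, hk, hxk⟩ := mem_iUnion₂.1 (hJ (mem_iUnion₂.2 ⟨j, Finset.mem_range.2 hj, hx⟩))
    refine hone k _ x ?_ (hχ1 k x hxk)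
    have : k ≤ J.sup id := Finset.le_sup (f := id) hk
    exact lt_max_of_lt_right (Nat.lt_succ_of_le this)
  choose S hS1 hS2 using hnext
  let N : ℕ → ℕ := fun i => Nat.rec 0 (fun _ M => S M) i
  have hNs : ∀ i, N (i + 1) = S (N i) := fun i => rfl
  have hN : StrictMono N := strictMono_nat_of_lt_succ fun i => by rw [hNs]; exact hS1 _
  refine ⟨ψ, c, N, hcW, rfl, hN, ?_, hψ0, ?_, ?_, ?_, ?_⟩
  · intro j
    exact (χ j).contDiff.mul (contDiff_prod fun k _ => contDiff_const.sub (χ k).contDiff)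
  · intro j
    exact (χ j).hasCompactSupport.mul_right
  · intro j
    refine (hψsupp j).trans ?_
    rw [hχt]
    exact Metric.closedBall_subset_ball (by linarith [hrc j])
  · intro M x
    rw [hsum]
    linarith [Finset.prod_nonneg fun k (_ : k ∈ Finset.range M) => hχ0 k x]
  · intro x hx
    classical
    have hex : ∃ i, 0 < ∑ j ∈ Finset.range (N i), ψ j x := by
      obtain ⟨j, hj⟩ := hcov x hx
      refine ⟨j + 1, ?_⟩
      rw [hone j _ x (lt_of_lt_of_le (Nat.lt_succ_self j) (hN.le_apply)) (hχ1 j x hj)]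
      exact one_pos
    obtain ⟨i, hi, hmin⟩ : ∃ i, 0 < ∑ j ∈ Finset.range (N (i + 1)), ψ j x ∧
        ∑ j ∈ Finset.range (N i), ψ j x ≤ 0 := by
      have h1 := Nat.find_spec hex
      obtain ⟨i, hi⟩ : ∃ i, Nat.find hex = i + 1 := by
        refine Nat.exists_eq_succ_of_ne_zero fun h0 => ?_
        rw [h0] at h1
        simp [N] at h1
      rw [hi] at h1
      exact ⟨i, h1, not_lt.1 (Nat.find_min hex (hi ▸ Nat.lt_succ_self i))⟩
    have hfull : ∑ j ∈ Finset.range (N (i + 2)), ψ j x = 1 := by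
      obtain ⟨j, hj, hjx⟩ := Finset.exists_ne_zero_of_sum_ne_zero hi.ne'
      refine hS2 (N (i + 1)) x ⟨j, Finset.mem_range.1 hj, hψsupp j (subset_tsupport _ hjx)⟩
    have e1 := Finset.sum_range_add_sum_Ico (fun j => ψ j x) (hN.monotone (Nat.le_succ i))
    have e2 := Finset.sum_range_add_sum_Ico (fun j => ψ j x) (hN.monotone (Nat.le_succ (i + 1)))
    simp only [Nat.succ_eq_add_one] at e1 e2
    rw [show i + 1 + 1 = i + 2 from rfl] at e2
    by_contra! hcon
    have c1 := hcon i
    have c2 := hcon (i + 1)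
    rw [show i + 1 + 1 = i + 2 from rfl] at c2
    linarith

/-- The unit vectors `e` for which `E` has zero `(e, α)`-width near `x`. -/
def unitDirections (E : Set 𝕏) (α : ℝ) (x : 𝕏) : Set 𝕏 :=
  {e | ‖e‖ = 1 ∧ ∃ r : ℝ, 0 < r ∧ width e α (Metric.ball x r ∩ E) = 0}

/-- The perturbations attached to the directions near `q` and the aperture `α`. -/
theorem exists_slot_perturbations {E F U : Set 𝕏} (hF : IsClosed F) (hU : IsOpen U)
    (hE : E = F ∩ U) (q : 𝕏) (δ : ℝ) {α : ℝ} (h0 : 0 ≤ α) (h1 : α ≤ 1 / 2) :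
    ∃ (Ψ : ℕ → 𝕏 → 𝕏) (θ : ℕ → 𝕏 → ℝ) (K : ℕ → Set 𝕏), (∀ i, IsCompact (K i)) ∧
      (∀ i, K i ⊆ U) ∧ (∀ i x, 0 ≤ θ i x) ∧ (∀ M x, ∑ i ∈ Finset.range M, θ i x ≤ 1) ∧
      (∀ i O, IsOpen O → E ⊆ O → ∀ ε : ℝ, 0 < ε → ε ≤ 1 → ∃ u : 𝕏 → ℝ, ContDiff ℝ 1 u ∧
        tsupport u ⊆ O ∩ K i ∧ (∀ x, |u x| ≤ ε) ∧ (∀ x, ‖fderiv ℝ u x‖ ≤ 3) ∧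
        ∀ x ∈ E, ‖fderiv ℝ u x - innerSL ℝ (Ψ i x)‖ ≤ 2 * α * θ i x + ε) ∧
      ∀ x ∈ E, (unitDirections E α x ∩ Metric.ball q δ).Nonempty → ∃ i, 1 / 2 ≤ θ i x ∧
        ∀ (y : 𝕏) (v τ : ℝ),
          (∀ e ∈ unitDirections E α x ∩ Metric.ball q δ, |(inner ℝ e y : ℝ) - v| ≤ τ) →
          |(inner ℝ (Ψ i x) y : ℝ) - θ i x * v| ≤ θ i x * τ := by
  set W : Set 𝕏 := {x | x ∈ U ∧ (unitDirections E α x ∩ Metric.ball q δ).Nonempty} with hWdef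
  rcases W.eq_empty_or_nonempty with hW | hW
  · refine ⟨fun _ _ => 0, fun _ _ => 0, fun _ => ∅, fun _ => isCompact_empty, fun _ => empty_subset _,
      fun _ _ => le_rfl, by simp, ?_, ?_⟩
    · intro i O _ _ ε hε _
      refine ⟨fun _ => 0, contDiff_const, by simp [tsupport], by simpa using hε.le, by simp, ?_⟩
      simpa using fun _ _ => hε.le
    · intro x hx hne
      have : x ∈ W := ⟨(hE ▸ hx : x ∈ F ∩ U).2, hne⟩
      rw [hW] at this
      exact this.elim
  · have hch : ∀ x ∈ W, ∃ (e : 𝕏) (r : ℝ), ‖e‖ = 1 ∧ e ∈ Metric.ball q δ ∧ 0 < r ∧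
        width e α (Metric.ball x r ∩ E) = 0 ∧ Metric.ball x r ⊆ U := by
      rintro x ⟨hxU, e, ⟨he, r, hr, hw⟩, heq⟩
      obtain ⟨s, hs, hsU⟩ := Metric.isOpen_iff.1 hU x hxU
      refine ⟨e, min r s, he, heq, lt_min hr hs, ?_,
        (Metric.ball_subset_ball (min_le_right _ _)).trans hsU⟩
      refine le_antisymm (le_trans (width_mono ?_) hw.le) zero_le
      exact inter_subset_inter_left _ (Metric.ball_subset_ball (min_le_left _ _))
    choose! e r he heq hr hw hrU using hch
    have hdir : ∀ x ∈ W, ∀ z ∈ Metric.ball x (r x), e x ∈ unitDirections E α z := by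
      intro x hx z hz
      refine ⟨he x hx, r x - dist z x, sub_pos.2 hz, ?_⟩
      refine le_antisymm (le_trans (width_mono ?_) (hw x hx).le) zero_le
      exact inter_subset_inter_left _ (Metric.ball_subset_ball' (by linarith))
    obtain ⟨ψ, c, N, hc, hN0, hN, hψ, hψ0, hψc, hψr, hψ1, hψW⟩ := exists_grouped_partition hW hr
      fun x hx z hz => ⟨hrU x hx hz, e x, hdir x hx z hz, heq x hx⟩
    refine ⟨fun i x => ∑ j ∈ Finset.Ico (N i) (N (i + 1)), ψ j x • e (c j),
      fun i x => ∑ j ∈ Finset.Ico (N i) (N (i + 1)), ψ j x,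
      fun i => ⋃ j ∈ Finset.Ico (N i) (N (i + 1)), tsupport (ψ j), ?_, ?_, ?_, ?_, ?_, ?_⟩
    · exact fun i => Finset.isCompact_biUnion _ fun j _ => hψc j
    · exact fun i => iUnion₂_subset fun j _ => (hψr j).trans (hrU _ (hc j))
    · exact fun i x => Finset.sum_nonneg fun j _ => hψ0 j x
    · intro M x
      have : ∑ i ∈ Finset.range M, ∑ j ∈ Finset.Ico (N i) (N (i + 1)), ψ j x =
          ∑ j ∈ Finset.range (N M), ψ j x := by
        induction M with
        | zero => simp [hN0]
        | succ M ih =>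
          rw [Finset.sum_range_succ, ih, Finset.sum_range_add_sum_Ico _ (hN.monotone M.le_succ)]
      rw [this]
      exact hψ1 _ x
    · intro i O hO hEO ε hε hε1
      obtain ⟨u, hu, hus, hue, hud, huE⟩ := exists_perturbation_sum
        (Finset.Ico (N i) (N (i + 1))) (E := E) (O := O)
        (B := fun j => Metric.ball (c j) (r (c j))) (e := fun j => e (c j)) (α := α) (ε := ε)
        (ψ := ψ) (fun j _ => he _ (hc j)) h0 h1 hε (fun j _ => hw _ (hc j)) (fun j _ => hψ j)
        (fun j _ => hψ0 j) (fun j _ => hψc j) (fun j _ => hψr j) (fun j _ => by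
          have : tsupport (ψ j) ∩ E = tsupport (ψ j) ∩ F := by
            rw [hE, ← inter_assoc, inter_eq_left]
            exact inter_subset_left.trans ((hψr j).trans (hrU _ (hc j)))
          rw [this]
          exact (hψc j).isCompact.inter_right hF) hO hEO
      refine ⟨u, hu, hus, hue, fun x => (hud x).trans ?_, huE⟩
      have : ∑ j ∈ Finset.Ico (N i) (N (i + 1)), ψ j x ≤ 1 := by
        refine le_trans (Finset.sum_le_sum_of_subset_of_nonneg ?_ fun j _ _ => hψ0 j x)
          (hψ1 (N (i + 1)) x)
        rw [Finset.range_eq_Ico]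
        exact Finset.Ico_subset_Ico_left (Nat.zero_le _)
      linarith
    · intro x hx hne
      obtain ⟨i, hi⟩ := hψW x ⟨(hE ▸ hx : x ∈ F ∩ U).2, hne⟩
      refine ⟨i, hi, fun y v τ H => ?_⟩
      rw [sum_inner, Finset.sum_mul, Finset.sum_mul, ← Finset.sum_sub_distrib]
      refine (Finset.abs_sum_le_sum_abs _ _).trans (Finset.sum_le_sum fun j _ => ?_)
      rw [real_inner_smul_left, ← mul_sub, abs_mul, abs_of_nonneg (hψ0 j x)]
      by_cases hj : x ∈ tsupport (ψ j)
      · exact mul_le_mul_of_nonneg_left (H _ ⟨hdir _ (hc j) _ (hψr j hj), heq _ (hc j)⟩) (hψ0 j x)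
      · simp [image_eq_zero_of_notMem_tsupport hj]

theorem width_le_of_coneSet_subset {e e' : 𝕏} {α α' : ℝ} (he : e ≠ 0) (he' : e' ≠ 0) (hα : α ≤ α')
    (h : coneSet e' α' ⊆ coneSet e α) (A : Set 𝕏) : width e' α' A ≤ width e α A := by
  by_cases h1 : 1 < α'
  · simp [width, h1]
  · have h2 : ¬ 1 < α := fun h3 => h1 (h3.trans_le hα)
    rw [width, width, if_neg (by simp [he', h1]), if_neg (by simp [he, h2])]
    refine iInf_mono fun G => iInf_mono fun _ => iInf_mono fun _ => ?_
    refine biSup_mono fun γ hγ => ⟨hγ.1, ?_⟩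
    filter_upwards [hγ.2] with t ht using h ht

theorem coneSet_smul (e : 𝕏) (α : ℝ) {c : ℝ} (hc : 0 < c) : coneSet (c • e) α = coneSet e α := by
  ext x
  simp only [coneSet, mem_ofPred_eq, norm_smul, real_inner_smul_right, Real.norm_eq_abs,
    abs_of_pos hc]
  rw [show α * ‖x‖ * (c * ‖e‖) = c * (α * ‖x‖ * ‖e‖) by ring, mul_le_mul_iff_right₀ hc]

theorem coneSet_subset_of_dist_le {e e' : 𝕏} {α α' : ℝ} (he : ‖e‖ = 1) (he' : ‖e'‖ = 1)
    (h : α + ‖e' - e‖ ≤ α') : coneSet e' α' ⊆ coneSet e α := by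
  intro x hx
  simp only [coneSet, mem_ofPred_eq, he, he', mul_one] at hx ⊢
  have h1 : (inner ℝ x (e' - e) : ℝ) ≤ ‖x‖ * ‖e' - e‖ := real_inner_le_norm _ _
  rw [inner_sub_right] at h1
  nlinarith [norm_nonneg x]

theorem zero_mem_normalSet (E : Set 𝕏) (x : 𝕏) : (0 : 𝕏) ∈ normalSet E x :=
  fun ε _ => ⟨1, one_pos, by simp [width]⟩

theorem normalSet_anti {A B : Set 𝕏} (h : A ⊆ B) (x : 𝕏) : normalSet B x ⊆ normalSet A x := by
  intro e he ε hε
  obtain ⟨r, hr, hw⟩ := he ε hε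
  exact ⟨r, hr, le_antisymm ((width_mono (inter_subset_inter_right _ h)).trans hw.le) zero_le⟩

theorem smul_mem_normalSet {E : Set 𝕏} {x e : 𝕏} (he : e ∈ normalSet E x) {c : ℝ} (hc : 0 < c) :
    c • e ∈ normalSet E x := by
  by_cases h0 : e = 0
  · rwa [h0, smul_zero, ← h0]
  intro ε hε
  obtain ⟨r, hr, hw⟩ := he ε hε
  refine ⟨r, hr, le_antisymm ((width_le_of_coneSet_subset h0 (smul_ne_zero hc.ne' h0) le_rfl
    (coneSet_smul e ε hc).subset _).trans hw.le) zero_le⟩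

/-- For small `α` the unit directions of aperture `α` are close to unit vectors of `𝒩(E,x)`. -/
theorem exists_near_normalSet (E : Set 𝕏) (x : 𝕏) {ε : ℝ} (hε : 0 < ε) :
    ∃ l₀ : ℕ, ∀ (l : ℕ) (α : ℝ), l₀ ≤ l → α ≤ (1 / 2) ^ l → ∀ e ∈ unitDirections E α x,
      ∃ e' ∈ normalSet E x ∩ Metric.sphere 0 1, ‖e' - e‖ < ε := by
  by_contra! hcon
  choose l α hl hα e he hfar using hcon
  have hes : ∀ k, e k ∈ Metric.sphere (0 : 𝕏) 1 := fun k => by simpa using (he k).1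
  obtain ⟨e₀, he₀, φ, hφ, hlim⟩ := (isCompact_sphere (0 : 𝕏) 1).tendsto_subseq hes
  have he₀1 : ‖e₀‖ = 1 := by simpa using he₀
  have hnorm : Tendsto (fun k => ‖e₀ - e (φ k)‖) atTop (𝓝 0) := by
    have := (tendsto_const_nhds (x := e₀)).sub hlim |>.norm
    simpa using this
  have hα0 : Tendsto (fun k => (1 / 2 : ℝ) ^ k) atTop (𝓝 0) :=
    tendsto_pow_atTop_nhds_zero_of_lt_one (by norm_num) (by norm_num)
  have hmem : e₀ ∈ normalSet E x := by
    intro η hη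
    obtain ⟨k, hk1, hk2⟩ := ((hnorm.eventually_lt_const (half_pos hη)).and
      (hα0.eventually_lt_const (half_pos hη))).exists
    obtain ⟨hek, r, hr, hw⟩ := he (φ k)
    have hαk : α (φ k) ≤ η / 2 := by
      have h1 : (1 / 2 : ℝ) ^ (l (φ k)) ≤ (1 / 2) ^ k :=
        pow_le_pow_of_le_one (by norm_num) (by norm_num) ((hφ.le_apply).trans (hl (φ k)))
      linarith [hα (φ k)]
    refine ⟨r, hr, le_antisymm ((width_le_of_coneSet_subset (e := e (φ k)) ?_ ?_ ?_
      (coneSet_subset_of_dist_le hek he₀1 (α := α (φ k)) ?_) _).trans hw.le) zero_le⟩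
    · rintro h; simp [h] at hek
    · rintro h; simp [h] at he₀1
    · linarith
    · linarith
  obtain ⟨k, hk⟩ := (hnorm.eventually_lt_const hε).exists
  exact absurd (hfar (φ k) e₀ ⟨hmem, he₀⟩) (not_le.2 hk)

/-- On the span of `S`, pairing with `y` is controlled by its values on `S`. -/
theorem exists_inner_bound_span (S : Set 𝕏) : ∃ C : ℝ, 0 ≤ C ∧ ∀ w ∈ Submodule.span ℝ S,
    ∀ (y : 𝕏) (ν : ℝ), (∀ e ∈ S, |(inner ℝ e y : ℝ)| ≤ ν) → |(inner ℝ w y : ℝ)| ≤ C * ‖w‖ * ν := by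
  obtain ⟨b, hbS, hspan, hli⟩ := exists_linearIndependent ℝ S
  have : Finite b := hli.finite
  have : Fintype b := Fintype.ofFinite b
  let β := Module.Basis.span hli
  refine ⟨∑ i, ‖LinearMap.toContinuousLinearMap (β.coord i)‖,
    by positivity, fun w hw y ν hν => ?_⟩
  have hw' : w ∈ Submodule.span ℝ (range ((↑) : b → 𝕏)) := by
    rw [Subtype.range_coe, hspan]; exact hw
  have hrep : w = ∑ i, β.coord i ⟨w, hw'⟩ • (i : 𝕏) := by
    have := congrArg Subtype.val (β.sum_repr ⟨w, hw'⟩)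
    simp only [Submodule.coe_sum, Submodule.coe_smul, β, Module.Basis.coe_span_apply] at this
    exact this.symm
  have hin : (inner ℝ w y : ℝ) = ∑ i, β.coord i ⟨w, hw'⟩ * inner ℝ (i : 𝕏) y := by
    conv_lhs => rw [hrep]
    simp only [sum_inner, real_inner_smul_left]
  rw [hin, Finset.sum_mul, Finset.sum_mul]
  refine (Finset.abs_sum_le_sum_abs _ _).trans (Finset.sum_le_sum fun i _ => ?_)
  rw [abs_mul]
  refine mul_le_mul ?_ (hν i (hbS i.2)) (abs_nonneg _) (by positivity)
  exact (LinearMap.toContinuousLinearMap (β.coord i)).le_opNorm ⟨w, hw'⟩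

theorem sum_range_unpair_le {g : ℕ → ℕ → ℝ} (hg : ∀ p i, 0 ≤ g p i) (M : ℕ) :
    ∑ m ∈ Finset.range M, g m.unpair.1 m.unpair.2 ≤
      ∑ p ∈ Finset.range M, ∑ i ∈ Finset.range M, g p i := by
  rw [← Finset.sum_product (f := fun q : ℕ × ℕ => g q.1 q.2)]
  rw [← Finset.sum_image (s := Finset.range M) (g := Nat.unpair) (f := fun q => g q.1 q.2)
    (Nat.pairEquiv.symm.injective.injOn)]
  refine Finset.sum_le_sum_of_subset_of_nonneg ?_ fun q _ _ => hg _ _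
  intro q hq
  obtain ⟨m, hm, rfl⟩ := Finset.mem_image.1 hq
  rw [Finset.mem_range] at hm
  exact Finset.mem_product.2 ⟨Finset.mem_range.2 ((Nat.unpair_left_le m).trans_lt hm),
    Finset.mem_range.2 ((Nat.unpair_right_le m).trans_lt hm)⟩

/-- The supremum of `⟨e, y⟩` over the vectors `e` of `𝒩(E,x)` in the unit ball. -/
noncomputable def normalSup (E : Set 𝕏) (x y : 𝕏) : ℝ :=
  sSup ((fun e => inner ℝ e y) '' (normalSet E x ∩ Metric.closedBall 0 1))

theorem bddAbove_normalSup (E : Set 𝕏) (x y : 𝕏) :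
    BddAbove ((fun e => (inner ℝ e y : ℝ)) '' (normalSet E x ∩ Metric.closedBall 0 1)) := by
  refine ⟨‖y‖, ?_⟩
  rintro _ ⟨e, ⟨-, he⟩, rfl⟩
  have h1 : ‖e‖ ≤ 1 := by simpa using he
  exact (real_inner_le_norm e y).trans (mul_le_of_le_one_left (norm_nonneg y) h1)

theorem normalSup_nonneg (E : Set 𝕏) (x y : 𝕏) : 0 ≤ normalSup E x y :=
  le_csSup (bddAbove_normalSup E x y) ⟨0, ⟨zero_mem_normalSet E x, by simp⟩, by simp⟩

/-- If `⟨·, y⟩` is not `0` on `𝒩(E,x)`, then its supremum is controlled by its modulus at a unit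
vector of `𝒩(E,x)`, which in turn dominates half of the modulus at the other ones. -/
theorem exists_almost_maximal {E : Set 𝕏} {x y : 𝕏} (h : 0 < normalSup E x y) :
    ∃ (ν : ℝ) (e₀ : 𝕏), normalSup E x y ≤ ν ∧ e₀ ∈ normalSet E x ∩ Metric.sphere 0 1 ∧
      ν / 2 < |(inner ℝ e₀ y : ℝ)| ∧
      ∀ e ∈ normalSet E x ∩ Metric.sphere 0 1, |(inner ℝ e y : ℝ)| ≤ ν := by
  set V : Set ℝ := (fun e => |(inner ℝ e y : ℝ)|) '' (normalSet E x ∩ Metric.sphere 0 1) with hV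
  have hbdd : BddAbove V := by
    refine ⟨‖y‖, ?_⟩
    rintro _ ⟨e, ⟨-, he⟩, rfl⟩
    have h1 : ‖e‖ = 1 := by simpa using he
    simpa [h1] using abs_real_inner_le_norm e y
  have hle : ∀ e ∈ normalSet E x ∩ Metric.sphere 0 1, |(inner ℝ e y : ℝ)| ≤ sSup V := fun e he =>
    le_csSup hbdd ⟨e, he, rfl⟩
  have hV0 : 0 ≤ sSup V := Real.sSup_nonneg (by rintro _ ⟨e, -, rfl⟩; exact abs_nonneg _)
  have hsup : normalSup E x y ≤ sSup V := by
    refine csSup_le ⟨_, 0, ⟨zero_mem_normalSet E x, by simp⟩, rfl⟩ ?_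
    rintro _ ⟨e, ⟨heN, he⟩, rfl⟩
    have h1 : ‖e‖ ≤ 1 := by simpa using he
    by_cases h0 : e = 0
    · simpa [h0] using hV0
    · have hpos : 0 < ‖e‖ := norm_pos_iff.2 h0
      have h2 := hle (‖e‖⁻¹ • e) ⟨smul_mem_normalSet heN (inv_pos.2 hpos), by
        simp [norm_smul, hpos.ne']⟩
      rw [real_inner_smul_left, abs_mul, abs_of_pos (inv_pos.2 hpos), inv_mul_le_iff₀ hpos] at h2
      exact (le_abs_self _).trans (h2.trans (mul_le_of_le_one_left hV0 h1))
  have hne : V.Nonempty := by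
    by_contra hcon
    rw [not_nonempty_iff_eq_empty] at hcon
    rw [hcon, Real.sSup_empty] at hsup
    linarith
  obtain ⟨_, ⟨e₀, he₀, rfl⟩, hlt⟩ := exists_lt_of_lt_csSup hne (half_lt_self (h.trans_le hsup))
  exact ⟨sSup V, e₀, hsup, he₀, hlt, hle⟩

theorem exists_oscillating_of_locallyClosed {E F U : Set 𝕏} (hF : IsClosed F) (hU : IsOpen U)
    (hE : E = F ∩ U) :
    ∃ f : 𝕏 → ℝ, LipschitzWith 8 f ∧ (∀ x, |f x| ≤ 1) ∧ (∀ x ∉ E, DifferentiableAt ℝ f x) ∧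
      ∀ x ∈ E, ∀ y, Oscillates f x y (1 / 8 * normalSup E x y) := by
  have hα0 : ∀ p : ℕ, (0 : ℝ) ≤ (1 / 2) ^ (p + 4) := fun p => by positivity
  have hα1 : ∀ p : ℕ, (1 / 2 : ℝ) ^ (p + 4) ≤ 1 / 2 := fun p =>
    (pow_le_pow_of_le_one (by norm_num) (by norm_num) (by omega : 1 ≤ p + 4)).trans (by norm_num)
  choose Ψ θ K hK hKU hθ0 hθ1 hstep hdir using fun p : ℕ => exists_slot_perturbations hF hU hE
    (TopologicalSpace.denseSeq 𝕏 p.unpair.1.unpair.1) (1 / ((p.unpair.1.unpair.2 : ℝ) + 1))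
    (hα0 p) (hα1 p)
  obtain ⟨f, hf8, hf1, hfd, hfo⟩ := exists_oscillating hF hU hE
    (Ψ := fun m => Ψ m.unpair.1 m.unpair.2)
    (b := fun m x => 2 * (1 / 2) ^ (m.unpair.1 + 4) * θ m.unpair.1 m.unpair.2 x)
    (K := fun m => K m.unpair.1 m.unpair.2) (fun m => hK _ _) (fun m => hKU _ _)
    (fun m x => mul_nonneg (by positivity) (hθ0 _ _ _)) (fun M x => by
      refine (sum_range_unpair_le (g := fun p i => 2 * (1 / 2) ^ (p + 4) * θ p i x)
        (fun p i => mul_nonneg (by positivity) (hθ0 _ _ _)) M).trans ?_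
      refine le_trans (Finset.sum_le_sum fun p _ => ?_) (sum_half_pow_le M)
      rw [← Finset.mul_sum]
      calc 2 * (1 / 2 : ℝ) ^ (p + 4) * ∑ i ∈ Finset.range M, θ p i x
          ≤ 2 * (1 / 2 : ℝ) ^ (p + 4) * 1 := by gcongr; exact hθ1 p M x
        _ = (1 / 2) ^ (p + 3) := by ring)
    (fun m => hstep _ _)
  refine ⟨f, hf8, hf1, hfd, fun x hx y => hfo x hx y _ ?_⟩
  rcases (normalSup_nonneg E x y).eq_or_lt with h | h
  · rw [← h, mul_zero]
    exact Frequently.of_forall fun m => abs_nonneg _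
  obtain ⟨ν, e₀, hν, he₀, he₀ν, hle⟩ := exists_almost_maximal h
  have hν0 : 0 < ν := h.trans_le hν
  obtain ⟨C, hC0, hC⟩ := exists_inner_bound_span (normalSet E x ∩ Metric.sphere 0 1)
  obtain ⟨k, hk⟩ := exists_nat_one_div_lt (show 0 < 1 / (32 * (C + 1)) by positivity)
  set δ : ℝ := 1 / ((k : ℝ) + 1) with hδ
  have hδ0 : 0 < δ := by positivity
  have hCδ : C * (2 * δ) ≤ 1 / 16 := by
    rw [lt_div_iff₀ (by positivity)] at hk
    nlinarith
  obtain ⟨ε, hε0, hεC, hεy⟩ : ∃ ε : ℝ, 0 < ε ∧ C * ε ≤ 1 / 16 ∧ ε * ‖y‖ ≤ ν / 16 := by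
    refine ⟨min (1 / (16 * (C + 1))) (ν / (16 * (‖y‖ + 1))), by positivity, ?_, ?_⟩
    · refine (mul_le_mul_of_nonneg_left (min_le_left _ _) hC0).trans ?_
      rw [mul_one_div, div_le_iff₀ (by positivity)]
      linarith
    · refine (mul_le_mul_of_nonneg_right (min_le_right _ _) (norm_nonneg y)).trans ?_
      rw [div_mul_eq_mul_div, div_le_iff₀ (by positivity)]
      nlinarith [norm_nonneg y]
  obtain ⟨a, ha⟩ := (TopologicalSpace.denseRange_denseSeq 𝕏).exists_dist_lt e₀ hδ0
  obtain ⟨l₀, hl₀⟩ := exists_near_normalSet E x hε0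
  rw [frequently_atTop]
  intro m₀
  set p := Nat.pair (Nat.pair a k) (max m₀ l₀) with hp
  have hp1 : p.unpair.1.unpair = (a, k) := by simp [hp]
  have hpl : max m₀ l₀ ≤ p := Nat.right_le_pair _ _
  have hdirp := hdir p x hx
  rw [hp1] at hdirp
  have he₀1 : ‖e₀‖ = 1 := by simpa using he₀.2
  obtain ⟨r, hr, hw⟩ := he₀.1 ((1 / 2) ^ (p + 4)) (by positivity)
  obtain ⟨i, hi, hin⟩ := hdirp ⟨e₀, ⟨he₀1, r, hr, hw⟩, ha⟩
  refine ⟨Nat.pair p i, ((le_max_left _ _).trans hpl).trans (Nat.left_le_pair p i), ?_⟩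
  simp only [Nat.unpair_pair]
  have key := hin y (inner ℝ e₀ y) (ν / 4) (by
    rintro e ⟨heu, heq⟩
    obtain ⟨e', he', hee'⟩ := hl₀ p ((1 / 2) ^ (p + 4)) ((le_max_right _ _).trans hpl)
      (pow_le_pow_of_le_one (by norm_num) (by norm_num) (by omega)) e heu
    have h1 : |(inner ℝ (e - e') y : ℝ)| ≤ ν / 16 := by
      refine (abs_real_inner_le_norm _ _).trans (le_trans ?_ hεy)
      rw [norm_sub_rev]
      gcongr
    have h2 : ‖e' - e₀‖ ≤ ε + 2 * δ := by
      have t1 := norm_sub_le_norm_sub_add_norm_sub e' e e₀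
      have t2 := dist_triangle_right e e₀ (TopologicalSpace.denseSeq 𝕏 a)
      rw [Metric.mem_ball] at heq
      rw [dist_eq_norm] at t2
      simp only at heq
      linarith
    have h3 : |(inner ℝ (e' - e₀) y : ℝ)| ≤ ν / 8 := by
      refine (hC _ (Submodule.sub_mem _ (Submodule.subset_span he')
        (Submodule.subset_span he₀)) y ν hle).trans ?_
      calc C * ‖e' - e₀‖ * ν ≤ C * (ε + 2 * δ) * ν := by gcongr
        _ ≤ (1 / 8) * ν := by gcongr; linarith
        _ = ν / 8 := by ring
    have h4 : (inner ℝ e y : ℝ) - inner ℝ e₀ y = inner ℝ (e - e') y + inner ℝ (e' - e₀) y := by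
      rw [← inner_add_left, sub_add_sub_cancel, inner_sub_left]
    rw [h4]
    refine (abs_add_le _ _).trans ?_
    linarith)
  have h5 := abs_sub_abs_le_abs_sub (θ p i x * inner ℝ e₀ y) (inner ℝ (Ψ p i x) y)
  rw [abs_sub_comm, abs_mul, abs_of_nonneg (hθ0 p i x)] at h5
  have h6 : (1 / 2) * (ν / 4) ≤ θ p i x * (|(inner ℝ e₀ y : ℝ)| - ν / 4) :=
    mul_le_mul hi (by linarith) (by positivity) (hθ0 p i x)
  linarith

theorem summable_mul_of_abs_le {w c : ℕ → ℝ} (hw : Summable w) (hw0 : ∀ i, 0 ≤ w i) {M : ℝ}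
    (hc : ∀ i, |c i| ≤ M) : Summable fun i => w i * c i :=
  Summable.of_norm_bounded (hw.mul_right M) fun i => by
    rw [norm_mul, Real.norm_eq_abs, Real.norm_eq_abs, abs_of_nonneg (hw0 i)]
    exact mul_le_mul_of_nonneg_left (hc i) (hw0 i)

theorem lipschitzWith_tsum {g : ℕ → 𝕏 → ℝ} {w : ℕ → ℝ} (hw : Summable w) (hw0 : ∀ i, 0 ≤ w i)
    {L : ℝ≥0} (hL : ∀ i, LipschitzWith L (g i)) {M : ℝ} (hM : ∀ i x, |g i x| ≤ M) :
    ∃ K : ℝ≥0, LipschitzWith K fun x => ∑' i, w i * g i x := by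
  have hs := fun x => summable_mul_of_abs_le hw hw0 (fun i => hM i x)
  refine ⟨Real.toNNReal ((∑' i, w i) * L), LipschitzWith.of_dist_le_mul fun x y => ?_⟩
  rw [Real.coe_toNNReal _ (mul_nonneg (tsum_nonneg hw0) L.coe_nonneg), Real.dist_eq, ← (hs x).tsum_sub (hs y),
    mul_assoc, ← tsum_mul_right, ← Real.norm_eq_abs]
  refine tsum_of_norm_bounded (hw.mul_right _).hasSum fun i => ?_
  rw [← mul_sub, norm_mul, Real.norm_eq_abs, abs_of_nonneg (hw0 i), ← dist_eq_norm]
  exact mul_le_mul_of_nonneg_left ((hL i).dist_le_mul x y) (hw0 i)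

theorem differentiableAt_tsum {g : ℕ → 𝕏 → ℝ} {w : ℕ → ℝ} (hw : Summable w) (hw0 : ∀ i, 0 ≤ w i)
    {L : ℝ≥0} (hL : ∀ i, LipschitzWith L (g i)) {M : ℝ} (hM : ∀ i x, |g i x| ≤ M) {x : 𝕏}
    (hd : ∀ i, DifferentiableAt ℝ (g i) x) :
    DifferentiableAt ℝ (fun x => ∑' i, w i * g i x) x := by
  have hs := fun x => summable_mul_of_abs_le hw hw0 (fun i => hM i x)
  have hD : ∀ i, ‖fderiv ℝ (g i) x‖ ≤ L := fun i => norm_fderiv_le_of_lipschitz ℝ (hL i)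
  have hDs : Summable fun i => w i • fderiv ℝ (g i) x :=
    Summable.of_norm_bounded (hw.mul_right (L : ℝ)) fun i => by
      rw [norm_smul, Real.norm_eq_abs, abs_of_nonneg (hw0 i)]
      exact mul_le_mul_of_nonneg_left (hD i) (hw0 i)
  have hDa : ∀ v, (∑' i, w i • fderiv ℝ (g i) x) v = ∑' i, w i * fderiv ℝ (g i) x v := fun v => by
    have := (ContinuousLinearMap.apply ℝ ℝ v).map_tsum hDs
    simpa using this
  have hDvs : ∀ v, Summable fun i => w i * fderiv ℝ (g i) x v := fun v =>
    summable_mul_of_abs_le hw hw0 (M := L * ‖v‖) fun i =>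
      ((fderiv ℝ (g i) x).le_opNorm v).trans (mul_le_mul_of_nonneg_right (hD i) (norm_nonneg v))
  refine HasFDerivAt.differentiableAt (f' := ∑' i, w i • fderiv ℝ (g i) x) ?_
  rw [hasFDerivAt_iff_tendsto]
  have key : Tendsto (fun z => ∑' i, w i * (‖z - x‖⁻¹ *
      (g i z - g i x - fderiv ℝ (g i) x (z - x)))) (𝓝 x) (𝓝 (∑' _ : ℕ, (0 : ℝ))) := by
    refine tendsto_tsum_of_dominated_convergence (hw.mul_right (L + L : ℝ)) (fun i => ?_)
      (Eventually.of_forall fun z i => ?_)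
    · rw [← mul_zero (w i)]
      refine Tendsto.const_mul _ ?_
      rw [tendsto_zero_iff_norm_tendsto_zero]
      refine (hasFDerivAt_iff_tendsto.1 (hd i).hasFDerivAt).congr fun z => ?_
      rw [norm_mul, norm_inv, norm_norm]
    · rw [norm_mul, norm_mul, norm_inv, norm_norm, Real.norm_eq_abs (w i), abs_of_nonneg (hw0 i)]
      refine mul_le_mul_of_nonneg_left ?_ (hw0 i)
      rcases eq_or_ne z x with rfl | hz
      · simp
      · have hzx : 0 < ‖z - x‖ := norm_pos_iff.2 (sub_ne_zero.2 hz)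
        rw [inv_mul_le_iff₀ hzx]
        refine (norm_sub_le _ _).trans ?_
        have h1 := (hL i).dist_le_mul z x
        have h2 := (fderiv ℝ (g i) x).le_of_opNorm_le (hD i) (z - x)
        rw [dist_eq_norm, dist_eq_norm] at h1
        linarith
  rw [tsum_zero] at key
  refine (tendsto_zero_iff_norm_tendsto_zero.1 key).congr fun z => ?_
  have : ∑' i, w i * (‖z - x‖⁻¹ * (g i z - g i x - fderiv ℝ (g i) x (z - x))) = ‖z - x‖⁻¹ *
      (∑' i, w i * g i z - ∑' i, w i * g i x - (∑' i, w i • fderiv ℝ (g i) x) (z - x)) := by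
    rw [hDa, ← (hs z).tsum_sub (hs x), ← ((hs z).sub (hs x)).tsum_sub (hDvs _), ← tsum_mul_left]
    exact tsum_congr fun i => by ring
  rw [this, norm_mul, norm_inv, norm_norm]

theorem tendsto_quotient {f : 𝕏 → ℝ} {x : 𝕏} (hf : DifferentiableAt ℝ f x) (y : 𝕏) :
    Tendsto (fun t : ℝ => (f (x + t • y) - f x) / t) (𝓝[>] 0) (𝓝 (fderiv ℝ f x y)) := by
  have := (hf.hasFDerivAt.hasLineDerivAt y).tendsto_slope_zero_right
  refine this.congr fun t => ?_
  rw [smul_eq_mul, div_eq_inv_mul]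

theorem Oscillates.mul_add {g R : 𝕏 → ℝ} {x y : 𝕏} {a c : ℝ} (h : Oscillates g x y a) (hc : 0 < c)
    (hR : DifferentiableAt ℝ R x) : Oscillates (fun z => c * g z + R z) x y (c * a) := by
  intro η hη ρ hρ
  have h1 := (tendsto_quotient hR y).eventually
    (Metric.ball_mem_nhds _ (show 0 < η / 4 by positivity))
  rw [eventually_nhdsWithin_iff, Metric.eventually_nhds_iff] at h1
  obtain ⟨σ, hσ, H⟩ := h1
  obtain ⟨t, ht, t', ht', hq⟩ := h (η / (2 * c)) (by positivity) (min ρ σ) (lt_min hρ hσ)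
  have hR' : ∀ s ∈ Ioo 0 (min ρ σ), |(R (x + s • y) - R x) / s - fderiv ℝ R x y| < η / 4 := by
    intro s hs
    have := H (y := s) (by
      rw [dist_zero_right, Real.norm_eq_abs, abs_of_pos hs.1]
      exact hs.2.trans_le (min_le_right _ _)) hs.1
    rwa [← Real.dist_eq]
  refine ⟨t, ⟨ht.1, ht.2.trans_le (min_le_left _ _)⟩, t',
    ⟨ht'.1, ht'.2.trans_le (min_le_left _ _)⟩, ?_⟩
  have e1 := abs_lt.1 (hR' t ht)
  have e2 := abs_lt.1 (hR' t' ht')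
  have e3 : ∀ s : ℝ, (c * g (x + s • y) + R (x + s • y) - (c * g x + R x)) / s =
      c * ((g (x + s • y) - g x) / s) + (R (x + s • y) - R x) / s := fun s => by ring
  have e4 := mul_le_mul_of_nonneg_left hq hc.le
  have e5 : c * (a - η / (2 * c)) = c * a - η / 2 := by field_simp
  rw [e3, e3]
  rw [e5] at e4
  linarith

theorem Oscillates.le_upperDeriv_sub_lowerDeriv {f : 𝕏 → ℝ} {x y : 𝕏} {a : ℝ} {K : ℝ≥0}
    (hf : LipschitzWith K f) (h : Oscillates f x y a) : a ≤ upperDeriv f x y - lowerDeriv f x y := by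
  set q : ℝ → ℝ := fun t => (f (x + t • y) - f x) / t with hq
  have hbd : ∀ t : ℝ, 0 < t → |q t| ≤ K * ‖y‖ := by
    intro t ht
    rw [hq, abs_div, abs_of_pos ht, div_le_iff₀ ht]
    have := hf.dist_le_mul (x + t • y) x
    rw [Real.dist_eq, dist_eq_norm, add_sub_cancel_left, norm_smul, Real.norm_eq_abs,
      abs_of_pos ht] at this
    linarith
  have hup : IsBoundedUnder (· ≤ ·) (𝓝[>] (0 : ℝ)) q :=
    ⟨K * ‖y‖, eventually_map.2 (eventually_mem_nhdsWithin.mono fun t ht => (abs_le.1 (hbd t ht)).2)⟩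
  have hlo : IsBoundedUnder (· ≥ ·) (𝓝[>] (0 : ℝ)) q :=
    ⟨-(K * ‖y‖), eventually_map.2
      (eventually_mem_nhdsWithin.mono fun t ht => (abs_le.1 (hbd t ht)).1)⟩
  refine le_of_forall_pos_le_add fun ε hε => ?_
  have h1 : ∀ᶠ t in 𝓝[>] (0 : ℝ), q t < upperDeriv f x y + ε / 3 :=
    eventually_lt_of_limsup_lt (by simp only [upperDeriv, hq]; linarith) hup
  have h2 : ∀ᶠ t in 𝓝[>] (0 : ℝ), lowerDeriv f x y - ε / 3 < q t :=
    eventually_lt_of_lt_liminf (by simp only [lowerDeriv, hq]; linarith) hlo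
  obtain ⟨ρ, hρ, H⟩ := (mem_nhdsGT_iff_exists_Ioo_subset).1 (h1.and h2)
  obtain ⟨t, ht, t', ht', hqq⟩ := h (ε / 3) (by positivity) ρ hρ
  have i1 := (H ht).1
  have i2 := (H ht').2
  simp only [hq] at i1 i2
  linarith

theorem upperDeriv_sub_lowerDeriv_eq_zero {f : 𝕏 → ℝ} {x : 𝕏} (hf : DifferentiableAt ℝ f x)
    (y : 𝕏) : upperDeriv f x y - lowerDeriv f x y = 0 := by
  have h := tendsto_quotient hf y
  rw [upperDeriv, lowerDeriv, h.limsup_eq, h.liminf_eq, sub_self]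

theorem normalSup_pos {E : Set 𝕏} {x e : 𝕏} (he : e ∈ normalSet E x) (h0 : e ≠ 0) :
    0 < normalSup E x e := by
  have hpos : 0 < ‖e‖ := norm_pos_iff.2 h0
  refine lt_of_lt_of_le hpos (le_csSup (bddAbove_normalSup E x e)
    ⟨‖e‖⁻¹ • e, ⟨smul_mem_normalSet he (inv_pos.2 hpos), by simp [norm_smul, hpos.ne']⟩, ?_⟩)
  simp only [real_inner_smul_left, real_inner_self_eq_norm_sq]
  field_simp

theorem normalSup_anti {A B : Set 𝕏} (h : A ⊆ B) (x y : 𝕏) : normalSup B x y ≤ normalSup A x y :=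
  csSup_le_csSup (bddAbove_normalSup A x y) ⟨_, 0, ⟨zero_mem_normalSet B x, by simp⟩, rfl⟩
    (image_mono (inter_subset_inter_left _ (normalSet_anti h x)))

end ConeUnrect


open ConeUnrect in
theorem mainTheorem4 (n : ℕ) (E : ℕ → Set (EuclideanSpace ℝ (Fin n)))
    (hdisj : Pairwise fun i j => Disjoint (E i) (E j))
    (hcone : ∀ k, ConeUnrect.IsConeUnrectifiable (E k))
    (hF : ∀ k, ConeUnrect.IsFSigma (E k)) :
    ∃ f : EuclideanSpace ℝ (Fin n) → ℝ,
      (∃ K : ℝ≥0, LipschitzWith K f) ∧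
      (∀ x, x ∉ ⋃ k, E k → DifferentiableAt ℝ f x) ∧
      (∀ k, ∀ x ∈ E k,
        (∃ c : ℝ, 0 < c ∧ ∀ y : EuclideanSpace ℝ (Fin n),
          c * sSup ((fun e => inner ℝ e y) ''
              (ConeUnrect.normalSet (E k) x ∩ Metric.closedBall 0 1)) ≤
            ConeUnrect.upperDeriv f x y - ConeUnrect.lowerDeriv f x y) ∧
        ¬ DifferentiableAt ℝ f x) := by
  choose F hFc hFE using hF
  set P : ℕ → Set (EuclideanSpace ℝ (Fin n)) := fun i =>
    F i.unpair.1 i.unpair.2 ∩ (⋃ j ∈ Finset.range i.unpair.2, F i.unpair.1 j)ᶜ with hP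
  have hPE : ∀ i, P i ⊆ E i.unpair.1 := fun i x hx => by
    rw [hFE]; exact Set.mem_iUnion.2 ⟨_, hx.1⟩
  have hPex : ∀ k, ∀ x ∈ E k, ∃ i, i.unpair.1 = k ∧ x ∈ P i := by
    classical
    intro k x hx
    rw [hFE] at hx
    have hex : ∃ j, x ∈ F k j := Set.mem_iUnion.1 hx
    refine ⟨Nat.pair k (Nat.find hex), by simp, ?_⟩
    simp only [hP, Nat.unpair_pair]
    refine ⟨Nat.find_spec hex, ?_⟩
    simp only [Set.mem_compl_iff, Set.mem_iUnion, Finset.mem_range, not_exists]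
    exact fun j hj => Nat.find_min hex hj
  have hPdisj : ∀ i j, i ≠ j → ∀ x ∈ P i, x ∉ P j := by
    intro i j hij x hxi hxj
    by_cases hk : i.unpair.1 = j.unpair.1
    · have hne : i.unpair.2 ≠ j.unpair.2 := fun h => hij (by
        rw [← Nat.pair_unpair i, ← Nat.pair_unpair j, hk, h])
      rcases lt_or_gt_of_ne hne with h | h
      · exact hxj.2 (Set.mem_iUnion₂.2 ⟨_, Finset.mem_range.2 h, hk ▸ hxi.1⟩)
      · exact hxi.2 (Set.mem_iUnion₂.2 ⟨_, Finset.mem_range.2 h, hk ▸ hxj.1⟩)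
    · exact Set.disjoint_left.1 (hdisj hk) (hPE i hxi) (hPE j hxj)
  choose g hg8 hg1 hgd hgo using fun i => exists_oscillating_of_locallyClosed
    (hFc i.unpair.1 i.unpair.2)
    (isOpen_compl_iff.2 (Set.Finite.isClosed_biUnion (Finset.range i.unpair.2).finite_toSet
      fun j _ => hFc i.unpair.1 j)) (E := P i) rfl
  have hw : Summable fun i : ℕ => (1 / 2 : ℝ) ^ i := summable_geometric_two
  have hw0 : ∀ i : ℕ, (0 : ℝ) ≤ (1 / 2) ^ i := fun i => by positivity
  obtain ⟨K, hK⟩ := lipschitzWith_tsum hw hw0 hg8 hg1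
  set f : EuclideanSpace ℝ (Fin n) → ℝ := fun x => ∑' i, (1 / 2 : ℝ) ^ i * g i x with hf
  have hosc : ∀ k, ∀ x ∈ E k, ∃ c : ℝ, 0 < c ∧ ∀ y,
      c * normalSup (E k) x y ≤ upperDeriv f x y - lowerDeriv f x y := by
    classical
    intro k x hx
    obtain ⟨i, rfl, hxi⟩ := hPex k x hx
    refine ⟨(1 / 2) ^ i * (1 / 8), by positivity, fun y => ?_⟩
    set g' : ℕ → EuclideanSpace ℝ (Fin n) → ℝ := fun j => if j = i then fun _ => 0 else g j
      with hg'
    have hR : DifferentiableAt ℝ (fun z => ∑' j, (1 / 2 : ℝ) ^ j * g' j z) x := by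
      refine differentiableAt_tsum hw hw0 (L := 8) (M := 1) (fun j => ?_) (fun j z => ?_)
        (fun j => ?_) <;> by_cases hj : j = i <;> simp only [hg', hj, if_true, if_false]
      · exact LipschitzWith.const' 0
      · exact hg8 j
      · simp
      · exact hg1 j z
      · exact differentiableAt_const 0
      · exact hgd j x (hPdisj i j (Ne.symm hj) x hxi)
    have hfR : f = fun z => (1 / 2 : ℝ) ^ i * g i z + ∑' j, (1 / 2 : ℝ) ^ j * g' j z := by
      funext z
      rw [hf]
      simp only
      rw [(summable_mul_of_abs_le hw hw0 (fun j => hg1 j z)).tsum_eq_add_tsum_ite i]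
      congr 1
      refine tsum_congr fun j => ?_
      by_cases hj : j = i <;> simp [hg', hj]
    have ho := (hgo i x hxi y).mul_add (c := (1 / 2) ^ i) (by positivity) hR
    rw [← hfR] at ho
    refine le_trans ?_ (ho.le_upperDeriv_sub_lowerDeriv hK)
    rw [mul_assoc]
    have := normalSup_anti (hPE i) x y
    gcongr
  refine ⟨f, ⟨K, hK⟩, fun x hx => ?_, fun k x hx => ⟨hosc k x hx, fun hd => ?_⟩⟩
  · refine differentiableAt_tsum hw hw0 hg8 hg1 fun i => hgd i x fun hxi => hx ?_
    exact Set.mem_iUnion.2 ⟨_, hPE i hxi⟩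
  · obtain ⟨c, hc, H⟩ := hosc k x hx
    obtain ⟨e, he, he0⟩ : ∃ e ∈ normalSet (E k) x, e ≠ 0 := by
      by_contra! hcon
      exact hcone k x hx (Set.eq_singleton_iff_unique_mem.2 ⟨zero_mem_normalSet _ _, hcon⟩)
    have h1 := H e
    rw [upperDeriv_sub_lowerDeriv_eq_zero hd] at h1
    have h2 := mul_pos hc (normalSup_pos he he0)
    linarith
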